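/- All systems are finite-dimensional. For a bipartite state $\rho^{AB}$, let $D(\rho^{A|B})$ be its two-way distillable entanglement: the supremum of all $R\ge 0$ for which there are integers $M_n$ and reals $\epsilon_n\to 0$ with $\frac1n\log_2 M_n\to R$ such that, for every sufficiently large $n$, some LOCC operation $\mathcal V_n$ (finitely many rounds of two-way classical communication) between Alice (holding $A^n$) and Bob (holding $B^n$) satisfies $F^2\bigl(\Phi^{M_n},\mathcal V_n(\rho^{\otimes n})\bigr)\ge 1-\epsilon_n$. Here $F(\rho,\sigma)=\operatorname{Tr}\sqrt{\rho^{1/2}\sigma\rho^{1/2}}$, and $\Phi^{M}$ is the maximally entangled state with state vector $\frac1{\sqrt M}\sum_{j=1}^M|j\rangle|j\rangle$. Let $\psi=\psi^{C_1\cdots C_mAB}$ be an arbitrary (pure or mixed) state, $m\ge 0$. The multipartite entanglement of assistance of $\psi$ is $$D_A(\psi)=\sup_{E_1,\dots,E_m}\ \sum_{k=(k_1,\dots,k_m)}p_k\,D(\psi_k^{A|B}),$$ where the supremum is over POVMs $E_i=\{E_{i,k_i}\}_{k_i}$ on $C_i$ with finitely many outcomes, $p_k=\operatorname{Tr}[(E_{1,k_1}\otimes\cdots\otimes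 E_{m,k_m}\otimes I_{AB})\psi]$ and $\psi_k^{AB}=\frac1{p_k}\operatorname{Tr}_{C_1\cdots C_m}[(E_{1,k_1}\otimes\cdots\otimes E_{m,k_m}\otimes I_{AB})\psi]$ (outcomes with $p_k=0$ contribute $0$). Its regularization is $$D_A^\infty(\psi)=\lim_{n\to\infty}\tfrac1n D_A(\psi^{\otimes n}),$$ where in $\psi^{\otimes n}$ the parties hold $C_1^n,\dots,C_m^n,A^n,B^n$. Then this limit exists, and $$D_A^\infty(\psi^{C_1\cdots C_mAB})\le\min_{\mathcal T}D(\psi^{A\mathcal T|B\overline{\mathcal T}}),$$ where the minimum is over all subsets $\mathcal T\subseteq\{C_1,\dots,C_m\}$ with complement $\overline{\mathcal T}$, and $\psi^{A\mathcal T|B\overline{\mathcal T}}$ is $\psi$ regarded as a bipartite state with Alice holding $A\mathcal T$ and Bob holding $B\overline{\mathcal T}$. -/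

import Mathlib

open Filter Topology
open scoped Matrix Kronecker ComplexOrder MatrixOrder ENNReal NNReal

noncomputable section

namespace AssistedDistillation

/-! Finite-dimensional quantum systems are given by finite index types (labels of an orthonormal
basis); operators are complex matrices over these types, and the tensor product of two systems has
the product type as its index type. -/

/-- A (mixed or pure) state: a density matrix. -/
def IsState {ι : Type} [Fintype ι] (ρ : Matrix ι ι ℂ) : Prop :=
  ρ.PosSemidef ∧ ρ.trace = 1

/-- The Uhlmann fidelity `F(ρ, σ) = Tr √(ρ^{1/2} σ ρ^{1/2})`. -/
def fidelity {ι : Type} [Fintype ι] [DecidableEq ι] (ρ σ : Matrix ι ι ℂ) : ℝ :=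
  (CFC.sqrt (CFC.sqrt ρ * σ * CFC.sqrt ρ)).trace.re

/-- The vector `|Φ^M⟩ = M^{-1/2} ∑ₘ |m⟩ ⊗ |m⟩`. -/
def maxEntVec (M : ℕ) : Fin M × Fin M → ℂ :=
  fun p => if p.1 = p.2 then ((1 / Real.sqrt M : ℝ) : ℂ) else 0

/-- The density matrix `|Φ^M⟩⟨Φ^M|` of the maximally entangled state of dimension `M`. -/
def maxEnt (M : ℕ) : Matrix (Fin M × Fin M) (Fin M × Fin M) ℂ :=
  Matrix.vecMulVec (maxEntVec M) (star (maxEntVec M))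

/-- `IsLOCC V` : the map `V` from operators on `AB` to operators on `A'B'` is implemented by local
operations and (two-way) classical communication, with finitely many rounds and finitely many
outcomes in each round. In a round, Alice (or Bob) applies a local quantum instrument to her (his)
system, with Kraus operators `K x : A → S x`, `∑ₓ K x† K x = 1`, and announces the outcome `x`; the
two parties proceed by an LOCC operation that depends on `x`. (The continuation may ignore part of
`x`, which covers coarse-grained instruments, local channels, discarding of systems, and local
randomness; the `K x` may enlarge the system, which covers local ancillas.) -/
inductive IsLOCC {a' b' : Type} [Fintype a'] [DecidableEq a'] [Fintype b'] [DecidableEq b'] :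
    ∀ {a b : Type} [Fintype a] [DecidableEq a] [Fintype b] [DecidableEq b],
      (Matrix (a × b) (a × b) ℂ → Matrix (a' × b') (a' × b') ℂ) → Prop
  | done : IsLOCC (fun ρ : Matrix (a' × b') (a' × b') ℂ => ρ)
  | alice {a b : Type} [Fintype a] [DecidableEq a] [Fintype b] [DecidableEq b]
      {κ : Type} [Fintype κ] (S : κ → Type) [∀ x, Fintype (S x)] [∀ x, DecidableEq (S x)]
      (K : ∀ x, Matrix (S x) a ℂ) (hK : ∑ x, (K x)ᴴ * K x = 1)
      (V : ∀ x, Matrix (S x × b) (S x × b) ℂ → Matrix (a' × b') (a' × b') ℂ)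
      (hV : ∀ x, IsLOCC (V x)) :
      IsLOCC (fun ρ : Matrix (a × b) (a × b) ℂ =>
        ∑ x, V x ((K x ⊗ₖ (1 : Matrix b b ℂ)) * ρ * (K x ⊗ₖ (1 : Matrix b b ℂ))ᴴ))
  | bob {a b : Type} [Fintype a] [DecidableEq a] [Fintype b] [DecidableEq b]
      {κ : Type} [Fintype κ] (S : κ → Type) [∀ x, Fintype (S x)] [∀ x, DecidableEq (S x)]
      (K : ∀ x, Matrix (S x) b ℂ) (hK : ∑ x, (K x)ᴴ * K x = 1)
      (V : ∀ x, Matrix (a × S x) (a × S x) ℂ → Matrix (a' × b') (a' × b') ℂ)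
      (hV : ∀ x, IsLOCC (V x)) :
      IsLOCC (fun ρ : Matrix (a × b) (a × b) ℂ =>
        ∑ x, V x (((1 : Matrix a a ℂ) ⊗ₖ K x) * ρ * ((1 : Matrix a a ℂ) ⊗ₖ K x)ᴴ))

section Bipartite

variable {a b : Type} [Fintype a] [DecidableEq a] [Fintype b] [DecidableEq b]

/-- `ρ^{⊗ n}` as a bipartite operator on `AⁿBⁿ`. -/
def bipartitePower (ρ : Matrix (a × b) (a × b) ℂ) (n : ℕ) :
    Matrix ((Fin n → a) × (Fin n → b)) ((Fin n → a) × (Fin n → b)) ℂ :=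
  Matrix.of fun p q => ∏ t, ρ (p.1 t, p.2 t) (q.1 t, q.2 t)

/-- `R` is an achievable rate of two-way entanglement distillation from `ρ`: for every sufficiently
large `n` there is an LOCC operation that takes `n` copies of `ρ` to a maximally entangled state of
dimension `M n` up to squared fidelity `1 - ε n`, where `ε n → 0` and `(1/n) log₂ (M n) → R`. -/
def IsAchievableRate (ρ : Matrix (a × b) (a × b) ℂ) (R : ℝ≥0) : Prop :=
  ∃ (M : ℕ → ℕ) (ε : ℕ → ℝ),
    Tendsto ε atTop (𝓝 0) ∧
    Tendsto (fun n : ℕ => (1 / (n : ℝ)) * Real.logb 2 (M n)) atTop (𝓝 (R : ℝ)) ∧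
    ∀ᶠ n : ℕ in atTop,
      ∃ V : Matrix ((Fin n → a) × (Fin n → b)) ((Fin n → a) × (Fin n → b)) ℂ →
          Matrix (Fin (M n) × Fin (M n)) (Fin (M n) × Fin (M n)) ℂ,
        IsLOCC V ∧ 1 - ε n ≤ fidelity (maxEnt (M n)) (V (bipartitePower ρ n)) ^ 2

/-- The two-way distillable entanglement `D(ρ^{AB})`: the supremum of the achievable rates, taken in
`[0, ∞]`. -/
def distillable (ρ : Matrix (a × b) (a × b) ℂ) : ℝ≥0∞ :=
  ⨆ (R : ℝ≥0) (_ : IsAchievableRate ρ R), (R : ℝ≥0∞)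

end Bipartite

/-- A positive operator valued measure with outcomes in `κ`. -/
structure POVM (κ c : Type) [Fintype κ] [Fintype c] [DecidableEq c] where
  effect : κ → Matrix c c ℂ
  posSemidef : ∀ x, (effect x).PosSemidef
  sum_eq_one : ∑ x, effect x = 1

section Multipartite

variable {m : ℕ} {c : Fin m → Type} [∀ i, Fintype (c i)] [∀ i, DecidableEq (c i)]
  {a b : Type} [Fintype a] [DecidableEq a] [Fintype b] [DecidableEq b]

/-- The tensor product `X₁ ⊗ ⋯ ⊗ X_m` of operators on the helpers' systems. -/
def helperTensor (X : ∀ i, Matrix (c i) (c i) ℂ) : Matrix (∀ i, c i) (∀ i, c i) ℂ :=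
  Matrix.of fun x y => ∏ i, X i (x i) (y i)

/-- The partial trace over all the helpers. -/
def traceHelpers (X : Matrix ((∀ i, c i) × (a × b)) ((∀ i, c i) × (a × b)) ℂ) :
    Matrix (a × b) (a × b) ℂ :=
  Matrix.of fun p q => ∑ x, X (x, p) (x, q)

/-- The unnormalized state `Tr_C[(E_{k₁} ⊗ ⋯ ⊗ E_{k_m} ⊗ I_{AB}) ψ]` of Alice and Bob, when the
helpers' measurement outcomes correspond to the effects `X i`. -/
def unnormalizedOutcome (ψ : Matrix ((∀ i, c i) × (a × b)) ((∀ i, c i) × (a × b)) ℂ)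
    (X : ∀ i, Matrix (c i) (c i) ℂ) : Matrix (a × b) (a × b) ℂ :=
  traceHelpers ((helperTensor X ⊗ₖ (1 : Matrix (a × b) (a × b) ℂ)) * ψ)

/-- The probability of that outcome. -/
def outcomeProb (ψ : Matrix ((∀ i, c i) × (a × b)) ((∀ i, c i) × (a × b)) ℂ)
    (X : ∀ i, Matrix (c i) (c i) ℂ) : ℝ :=
  (unnormalizedOutcome ψ X).trace.re

/-- The state of Alice and Bob after that outcome. -/
def outcomeState (ψ : Matrix ((∀ i, c i) × (a × b)) ((∀ i, c i) × (a × b)) ℂ)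
    (X : ∀ i, Matrix (c i) (c i) ℂ) : Matrix (a × b) (a × b) ℂ :=
  (((outcomeProb ψ X)⁻¹ : ℝ) : ℂ) • unnormalizedOutcome ψ X

/-- The one-shot multipartite entanglement of assistance `D_A(ψ^{C₁⋯C_m AB})`: the supremum over
POVMs `E₁, …, E_m` of the helpers (with finitely many outcomes) of
`∑_k p_k D(ψ_k^{AB})`, `k = (k₁, …, k_m)`. -/
def assistance (ψ : Matrix ((∀ i, c i) × (a × b)) ((∀ i, c i) × (a × b)) ℂ) : ℝ≥0∞ :=
  ⨆ (κ : Fin m → ℕ) (E : ∀ i, POVM (Fin (κ i)) (c i)),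
    ∑ k : ∀ i, Fin (κ i),
      ENNReal.ofReal (outcomeProb ψ fun i => (E i).effect (k i)) *
        distillable (outcomeState ψ fun i => (E i).effect (k i))

/-- `ψ^{⊗ n}` as a multipartite operator: the `i`-th helper holds `C_iⁿ`, Alice `Aⁿ`, Bob `Bⁿ`. -/
def multipartitePower (ψ : Matrix ((∀ i, c i) × (a × b)) ((∀ i, c i) × (a × b)) ℂ) (n : ℕ) :
    Matrix ((∀ i, Fin n → c i) × ((Fin n → a) × (Fin n → b)))
      ((∀ i, Fin n → c i) × ((Fin n → a) × (Fin n → b))) ℂ :=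
  Matrix.of fun p q =>
    ∏ t, ψ (fun i => p.1 i t, p.2.1 t, p.2.2 t) (fun i => q.1 i t, q.2.1 t, q.2.2 t)

/-- The sequence `(1/n) D_A(ψ^{⊗ n})`. -/
def assistanceRate (ψ : Matrix ((∀ i, c i) × (a × b)) ((∀ i, c i) × (a × b)) ℂ) (n : ℕ) : ℝ≥0∞ :=
  assistance (multipartitePower ψ n) / n

/-- The asymptotic multipartite entanglement of assistance
`D_A^∞(ψ) = lim_{n → ∞} (1/n) D_A(ψ^{⊗ n})`. -/
def asymptoticAssistance (ψ : Matrix ((∀ i, c i) × (a × b)) ((∀ i, c i) × (a × b)) ℂ) : ℝ≥0∞ :=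
  limUnder atTop (assistanceRate ψ)

/-- The bipartite operator `ψ^{A𝒯|B𝒯ᶜ}`: Alice holds `A` and the systems of the helpers in `T`, Bob
holds `B` and the systems of the other helpers. -/
def cutState (ψ : Matrix ((∀ i, c i) × (a × b)) ((∀ i, c i) × (a × b)) ℂ) (T : Finset (Fin m)) :
    Matrix ((a × (∀ i : {i // i ∈ T}, c i)) × (b × (∀ i : {i // i ∉ T}, c i)))
      ((a × (∀ i : {i // i ∈ T}, c i)) × (b × (∀ i : {i // i ∉ T}, c i))) ℂ :=
  let regroup : (a × (∀ i : {i // i ∈ T}, c i)) × (b × (∀ i : {i // i ∉ T}, c i)) →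
      (∀ i, c i) × (a × b) :=
    fun p => (fun i => if h : i ∈ T then p.1.2 ⟨i, h⟩ else p.2.2 ⟨i, h⟩, p.1.1, p.2.1)
  ψ.submatrix regroup regroup

end Multipartite

end AssistedDistillation

end

/-!
# Entanglement of assistance is bounded by the distillable entanglement across every cut

For a fixed cut `T`, Alice can perform the measurements of the helpers in `T` and Bob those of the
others, and then distil. So it suffices to compare distillation from many copies of the cut state
with distillation after a local measurement.

*One cut.* The target `Φ^M` is pure, so the squared fidelity with it is the linear functional
`σ ↦ ⟨Φ^M|σ|Φ^M⟩` (`fidelity_maxEnt_sq`), and a protocol is recorded only through the value of this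
functional at its output (`Attains`). These values add up over the outcomes of a local measurement
(`IsLocalInstrument.attains`) and multiply under parallel protocols (`Attains.tensor`); surplus
copies can be discarded (`Attains.localTensor_const`). Given `N` copies, Alice and Bob measure each
of them and sort the copies by outcome. With probability tending to one each outcome `k` occurs at
least `N p_k - o(N)` times, by Chebyshev's inequality (`le_sum_prod_typical`), and distilling each
group separately yields the rate `∑ p_k R_k` (`IsLocalInstrument.isAchievableRate`). Hence
`∑ p_k D(ψ_k) ≤ D` across the cut (`IsLocalInstrument.sum_distillable_le`), which for the helpers'
measurements reads `assistance_le_distillable_cutState`.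

*Many copies.* Applied to `ψ^{⊗ n}`, this bounds `D_A(ψ^{⊗ n})` by the distillable entanglement of
`n` copies of the cut state, which is at most `n` times that of one copy
(`distillable_bipartitePower_le`).

*The limit.* Product measurements and parallel distillation make `n ↦ D_A(ψ^{⊗ n})` superadditive
(`assistance_multipartitePower_add_le`), so by Fekete's lemma in `[0, ∞]`
(`tendsto_div_of_superadditive`) the limit exists and is the supremum of `D_A(ψ^{⊗ n}) / n`, each
term of which obeys the bound above.
-/

noncomputable section

namespace AssistedDistillation

/-! ### Overlap with the maximally entangled state -/

/-- The overlap `⟨Φ^M|σ|Φ^M⟩` with the maximally entangled state. -/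
def maxEntOverlap {M : ℕ} (σ : Matrix (Fin M × Fin M) (Fin M × Fin M) ℂ) : ℂ :=
  star (maxEntVec M) ⬝ᵥ (σ *ᵥ maxEntVec M)

theorem maxEntOverlap_eq_sum {M : ℕ} (σ : Matrix (Fin M × Fin M) (Fin M × Fin M) ℂ) :
    maxEntOverlap σ = (M : ℂ)⁻¹ * ∑ i, ∑ j, σ (i, i) (j, j) := by
  have h : (((Real.sqrt M)⁻¹ : ℝ) : ℂ) * (((Real.sqrt M)⁻¹ : ℝ) : ℂ) = (M : ℂ)⁻¹ := by
    rw [← Complex.ofReal_mul, ← mul_inv, Real.mul_self_sqrt (Nat.cast_nonneg M)]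
    simp
  simp only [maxEntOverlap, dotProduct, Matrix.mulVec, maxEntVec, Fintype.sum_prod_type,
    Pi.star_apply, one_div, mul_ite, mul_zero, Finset.sum_ite_eq, Finset.mem_univ, if_true,
    apply_ite star, star_zero, ite_mul, zero_mul]
  rw [Finset.mul_sum]
  refine Finset.sum_congr rfl fun i _ => ?_
  rw [← Finset.sum_mul, ← h]
  simp only [RCLike.star_def, Complex.conj_ofReal]
  ring

theorem maxEntVec_normSq {M : ℕ} (hM : M ≠ 0) :
    star (maxEntVec M) ⬝ᵥ maxEntVec M = 1 := by
  have := maxEntOverlap_eq_sum (1 : Matrix (Fin M × Fin M) (Fin M × Fin M) ℂ)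
  simpa [maxEntOverlap, Matrix.one_apply, hM] using this

theorem maxEnt_mul_mul_maxEnt {M : ℕ} (σ : Matrix (Fin M × Fin M) (Fin M × Fin M) ℂ) :
    maxEnt M * σ * maxEnt M = maxEntOverlap σ • maxEnt M := by
  rw [maxEnt, Matrix.vecMulVec_mul, Matrix.vecMulVec_mul_vecMulVec, maxEntOverlap,
    Matrix.dotProduct_mulVec]
  ext p q
  simp [Matrix.vecMulVec_apply]
  ring

theorem maxEnt_mul_self {M : ℕ} (hM : M ≠ 0) : maxEnt M * maxEnt M = maxEnt M := by
  have := maxEnt_mul_mul_maxEnt (1 : Matrix (Fin M × Fin M) (Fin M × Fin M) ℂ)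
  simpa [maxEntOverlap, maxEntVec_normSq hM] using this

theorem trace_maxEnt {M : ℕ} (hM : M ≠ 0) : (maxEnt M).trace = 1 := by
  rw [maxEnt, Matrix.trace_vecMulVec, dotProduct_comm, maxEntVec_normSq hM]

/-- Against a pure target the squared fidelity is an overlap, hence linear in the state. -/
theorem fidelity_maxEnt_sq {M : ℕ} {σ : Matrix (Fin M × Fin M) (Fin M × Fin M) ℂ}
    (hσ : σ.PosSemidef) : fidelity (maxEnt M) σ ^ 2 = (maxEntOverlap σ).re := by
  rcases eq_or_ne M 0 with rfl | hM
  · simp [fidelity, maxEntOverlap, Matrix.trace, dotProduct]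
  have hpos : (maxEnt M).PosSemidef := Matrix.posSemidef_vecMulVec_self_star _
  have hsqrt : CFC.sqrt (maxEnt M) = maxEnt M :=
    CFC.sqrt_unique (maxEnt_mul_self hM) hpos.nonneg
  have hnn : 0 ≤ maxEntOverlap σ := hσ.dotProduct_mulVec_nonneg _
  obtain ⟨hre, him⟩ := Complex.le_def.mp hnn
  set r := (maxEntOverlap σ).re with hr
  have hz : maxEntOverlap σ = (r : ℂ) := Complex.ext rfl (by simpa using him.symm)
  have hroot : CFC.sqrt (maxEntOverlap σ • maxEnt M) = ((Real.sqrt r : ℝ) : ℂ) • maxEnt M := by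
    refine CFC.sqrt_unique ?_ ?_
    · rw [smul_mul_smul_comm, maxEnt_mul_self hM, ← Complex.ofReal_mul,
        Real.mul_self_sqrt (by simpa using hre), hz]
    · refine (hpos.smul ?_).nonneg
      exact_mod_cast Real.sqrt_nonneg r
  rw [fidelity, hsqrt, maxEnt_mul_mul_maxEnt, hroot, Matrix.trace_smul, trace_maxEnt hM]
  simp [Real.sq_sqrt (show 0 ≤ r by simpa using hre)]

theorem maxEntOverlap_add {M : ℕ} (σ τ : Matrix (Fin M × Fin M) (Fin M × Fin M) ℂ) :
    maxEntOverlap (σ + τ) = maxEntOverlap σ + maxEntOverlap τ := by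
  simp [maxEntOverlap, Matrix.add_mulVec]

theorem maxEntOverlap_smul {M : ℕ} (z : ℂ) (σ : Matrix (Fin M × Fin M) (Fin M × Fin M) ℂ) :
    maxEntOverlap (z • σ) = z * maxEntOverlap σ := by
  simp [maxEntOverlap, Matrix.smul_mulVec]

theorem maxEntOverlap_sum {M : ℕ} {κ : Type*} (s : Finset κ)
    (σ : κ → Matrix (Fin M × Fin M) (Fin M × Fin M) ℂ) :
    maxEntOverlap (∑ x ∈ s, σ x) = ∑ x ∈ s, maxEntOverlap (σ x) := by
  simp [maxEntOverlap, Matrix.sum_mulVec, dotProduct_sum]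

/-! ### LOCC operations are linear and positive -/

theorem IsLOCC.isLinearMap {a b a' b' : Type} [Fintype a] [DecidableEq a] [Fintype b]
    [DecidableEq b] [Fintype a'] [DecidableEq a'] [Fintype b'] [DecidableEq b']
    {V : Matrix (a × b) (a × b) ℂ → Matrix (a' × b') (a' × b') ℂ} (hV : IsLOCC V) :
    IsLinearMap ℂ V := by
  induction hV with
  | done => exact ⟨fun _ _ => rfl, fun _ _ => rfl⟩
  | alice S K hK V hV ih =>
    refine ⟨fun ρ σ => ?_, fun z ρ => ?_⟩
    · simp only [Matrix.mul_add, Matrix.add_mul, (ih _).map_add, Finset.sum_add_distrib]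
    · simp only [Matrix.mul_smul, Matrix.smul_mul, (ih _).map_smul, Finset.smul_sum]
  | bob S K hK V hV ih =>
    refine ⟨fun ρ σ => ?_, fun z ρ => ?_⟩
    · simp only [Matrix.mul_add, Matrix.add_mul, (ih _).map_add, Finset.sum_add_distrib]
    · simp only [Matrix.mul_smul, Matrix.smul_mul, (ih _).map_smul, Finset.smul_sum]

theorem IsLOCC.posSemidef {a b a' b' : Type} [Fintype a] [DecidableEq a] [Fintype b]
    [DecidableEq b] [Fintype a'] [DecidableEq a'] [Fintype b'] [DecidableEq b']
    {V : Matrix (a × b) (a × b) ℂ → Matrix (a' × b') (a' × b') ℂ} (hV : IsLOCC V)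
    {ρ : Matrix (a × b) (a × b) ℂ} (hρ : ρ.PosSemidef) : (V ρ).PosSemidef := by
  induction hV with
  | done => exact hρ
  | alice S K hK V hV ih =>
    exact Matrix.posSemidef_sum _ fun x _ => ih x (hρ.mul_mul_conjTranspose_same _)
  | bob S K hK V hV ih =>
    exact Matrix.posSemidef_sum _ fun x _ => ih x (hρ.mul_mul_conjTranspose_same _)

/-! ### Tensor products of families of operators -/

/-- The tensor product `⨂ₜ A t` of a family of (rectangular) matrices. -/
def piTensor {τ : Type} [Fintype τ] {a b : τ → Type} (A : ∀ t, Matrix (a t) (b t) ℂ) :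
    Matrix (∀ t, a t) (∀ t, b t) ℂ :=
  Matrix.of fun p q => ∏ t, A t (p t) (q t)

section piTensor

variable {τ : Type} [Fintype τ] {a b d : τ → Type}

theorem piTensor_mul [DecidableEq τ] [∀ t, Fintype (b t)] (A : ∀ t, Matrix (a t) (b t) ℂ)
    (B : ∀ t, Matrix (b t) (d t) ℂ) :
    piTensor A * piTensor B = piTensor fun t => A t * B t := by
  ext p q
  simp only [piTensor, Matrix.mul_apply, Matrix.of_apply, Finset.prod_univ_sum,
    Fintype.piFinset_univ, Finset.prod_mul_distrib]

theorem piTensor_conjTranspose (A : ∀ t, Matrix (a t) (b t) ℂ) :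
    (piTensor A)ᴴ = piTensor fun t => (A t)ᴴ := by
  ext p q
  simp [piTensor, Matrix.conjTranspose_apply]

theorem piTensor_one [∀ t, DecidableEq (a t)] :
    piTensor (fun t => (1 : Matrix (a t) (a t) ℂ)) = 1 := by
  ext p q
  simp only [piTensor, Matrix.of_apply, Matrix.one_apply, Finset.prod_ite_zero, funext_iff]
  simp

theorem trace_piTensor [DecidableEq τ] [∀ t, Fintype (a t)] (A : ∀ t, Matrix (a t) (a t) ℂ) :
    (piTensor A).trace = ∏ t, (A t).trace := by
  simp only [piTensor, Matrix.trace, Matrix.diag_apply, Matrix.of_apply, Finset.prod_univ_sum,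
    Fintype.piFinset_univ]

theorem sum_piTensor [DecidableEq τ] {κ : τ → Type} (s : ∀ t, Finset (κ t))
    (A : ∀ t, κ t → Matrix (a t) (b t) ℂ) :
    ∑ x ∈ Fintype.piFinset s, piTensor (fun t => A t (x t)) =
      piTensor fun t => ∑ j ∈ s t, A t j := by
  ext p q
  simp only [piTensor, Matrix.sum_apply, Matrix.of_apply, Finset.prod_univ_sum]

end piTensor

theorem exists_eq_conjTranspose_mul_self {ι : Type} [Fintype ι] [DecidableEq ι]
    {A : Matrix ι ι ℂ} (hA : A.PosSemidef) : ∃ B : Matrix ι ι ℂ, A = Bᴴ * B := by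
  refine ⟨CFC.sqrt A, ?_⟩
  rw [(Matrix.nonneg_iff_posSemidef.mp (CFC.sqrt_nonneg A)).isHermitian.eq,
    CFC.sqrt_mul_sqrt_self A hA.nonneg]

theorem posSemidef_piTensor {τ : Type} [Fintype τ] {a : τ → Type} [∀ t, Fintype (a t)]
    [∀ t, DecidableEq (a t)]
    {A : ∀ t, Matrix (a t) (a t) ℂ} (hA : ∀ t, (A t).PosSemidef) : (piTensor A).PosSemidef := by
  classical
  choose B hB using fun t => exists_eq_conjTranspose_mul_self (hA t)
  have : piTensor A = (piTensor B)ᴴ * piTensor B := by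
    rw [piTensor_conjTranspose, piTensor_mul]
    exact congrArg piTensor (funext hB)
  rw [this]
  exact Matrix.posSemidef_conjTranspose_mul_self _

/-- The tensor product of a family of bipartite (rectangular) matrices, with Alice's systems grouped
together and Bob's systems grouped together. -/
def localTensor {τ : Type} [Fintype τ] {a b c d : Type} (ω : τ → Matrix (a × b) (c × d) ℂ) :
    Matrix ((τ → a) × (τ → b)) ((τ → c) × (τ → d)) ℂ :=
  Matrix.of fun p q => ∏ t, ω t (p.1 t, p.2 t) (q.1 t, q.2 t)

section localTensor

variable {τ : Type} [Fintype τ] {a b c d e f : Type}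

theorem localTensor_eq_submatrix (ω : τ → Matrix (a × b) (c × d) ℂ) :
    localTensor ω = (piTensor ω).submatrix (Equiv.arrowProdEquivProdArrow τ _ _).symm
      (Equiv.arrowProdEquivProdArrow τ _ _).symm := rfl

theorem localTensor_mul [DecidableEq τ] [Fintype c] [Fintype d]
    (ω : τ → Matrix (a × b) (c × d) ℂ)
    (ω' : τ → Matrix (c × d) (e × f) ℂ) :
    localTensor ω * localTensor ω' = localTensor fun t => ω t * ω' t := by
  rw [localTensor_eq_submatrix, localTensor_eq_submatrix, Matrix.submatrix_mul_equiv,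
    piTensor_mul, localTensor_eq_submatrix]

theorem localTensor_conjTranspose (ω : τ → Matrix (a × b) (c × d) ℂ) :
    (localTensor ω)ᴴ = localTensor fun t => (ω t)ᴴ := by
  rw [localTensor_eq_submatrix, Matrix.conjTranspose_submatrix, piTensor_conjTranspose,
    localTensor_eq_submatrix]

theorem trace_localTensor [DecidableEq τ] [Fintype a] [Fintype b]
    (ω : τ → Matrix (a × b) (a × b) ℂ) : (localTensor ω).trace = ∏ t, (ω t).trace := by
  rw [← trace_piTensor, localTensor_eq_submatrix]
  exact Fintype.sum_equiv (Equiv.arrowProdEquivProdArrow τ _ _).symm _ _ fun _ => rfl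

theorem posSemidef_localTensor [Fintype a] [Fintype b] [DecidableEq a] [DecidableEq b]
    {ω : τ → Matrix (a × b) (a × b) ℂ}
    (hω : ∀ t, (ω t).PosSemidef) : (localTensor ω).PosSemidef := by
  rw [localTensor_eq_submatrix]
  exact (posSemidef_piTensor hω).submatrix _

theorem sum_localTensor [DecidableEq τ] {κ : τ → Type} (s : ∀ t, Finset (κ t))
    (ω : ∀ t, κ t → Matrix (a × b) (c × d) ℂ) :
    ∑ x ∈ Fintype.piFinset s, localTensor (fun t => ω t (x t)) =
      localTensor fun t => ∑ j ∈ s t, ω t j := by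
  rw [localTensor_eq_submatrix, ← sum_piTensor]
  ext p q
  simp only [Matrix.sum_apply, Matrix.submatrix_apply]
  rfl

theorem localTensor_kronecker (A : τ → Matrix a c ℂ) (B : τ → Matrix b d ℂ) :
    localTensor (fun t => A t ⊗ₖ B t) = piTensor A ⊗ₖ piTensor B := by
  ext p q
  simp [localTensor, piTensor, Matrix.kroneckerMap_apply, Finset.prod_mul_distrib]

theorem localTensor_smul (z : ℂ) (ω : Matrix (a × b) (c × d) ℂ) :
    localTensor (fun _ : τ => z • ω) = z ^ Fintype.card τ • localTensor (fun _ : τ => ω) := by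
  ext p q
  simp [localTensor, Finset.prod_mul_distrib]

end localTensor

/-- The tensor product of two bipartite (rectangular) matrices, with Alice's systems grouped
together and Bob's systems grouped together. -/
def bipartiteTensor {a₁ b₁ c₁ d₁ a₂ b₂ c₂ d₂ : Type} (ρ : Matrix (a₁ × b₁) (c₁ × d₁) ℂ)
    (σ : Matrix (a₂ × b₂) (c₂ × d₂) ℂ) :
    Matrix ((a₁ × a₂) × (b₁ × b₂)) ((c₁ × c₂) × (d₁ × d₂)) ℂ :=
  Matrix.of fun p q => ρ (p.1.1, p.2.1) (q.1.1, q.2.1) * σ (p.1.2, p.2.2) (q.1.2, q.2.2)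

section bipartiteTensor

variable {a₁ b₁ c₁ d₁ a₂ b₂ c₂ d₂ e₁ f₁ e₂ f₂ : Type}

theorem bipartiteTensor_eq_submatrix (ρ : Matrix (a₁ × b₁) (c₁ × d₁) ℂ)
    (σ : Matrix (a₂ × b₂) (c₂ × d₂) ℂ) : bipartiteTensor ρ σ =
      (ρ ⊗ₖ σ).submatrix (Equiv.prodProdProdComm a₁ a₂ b₁ b₂)
        (Equiv.prodProdProdComm c₁ c₂ d₁ d₂) := rfl

theorem bipartiteTensor_mul [Fintype c₁] [Fintype d₁] [Fintype c₂] [Fintype d₂]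
    (ρ : Matrix (a₁ × b₁) (c₁ × d₁) ℂ) (σ : Matrix (a₂ × b₂) (c₂ × d₂) ℂ)
    (ρ' : Matrix (c₁ × d₁) (e₁ × f₁) ℂ) (σ' : Matrix (c₂ × d₂) (e₂ × f₂) ℂ) :
    bipartiteTensor ρ σ * bipartiteTensor ρ' σ' = bipartiteTensor (ρ * ρ') (σ * σ') := by
  rw [bipartiteTensor_eq_submatrix, bipartiteTensor_eq_submatrix, Matrix.submatrix_mul_equiv,
    ← Matrix.mul_kronecker_mul, bipartiteTensor_eq_submatrix]

theorem bipartiteTensor_conjTranspose (ρ : Matrix (a₁ × b₁) (c₁ × d₁) ℂ)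
    (σ : Matrix (a₂ × b₂) (c₂ × d₂) ℂ) :
    (bipartiteTensor ρ σ)ᴴ = bipartiteTensor ρᴴ σᴴ := by
  rw [bipartiteTensor_eq_submatrix, Matrix.conjTranspose_submatrix,
    Matrix.conjTranspose_kronecker, bipartiteTensor_eq_submatrix]

theorem bipartiteTensor_kronecker (A : Matrix a₁ c₁ ℂ) (B : Matrix b₁ d₁ ℂ) (C : Matrix a₂ c₂ ℂ)
    (D : Matrix b₂ d₂ ℂ) :
    bipartiteTensor (A ⊗ₖ B) (C ⊗ₖ D) = (A ⊗ₖ C) ⊗ₖ (B ⊗ₖ D) := by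
  ext p q
  simp only [bipartiteTensor, Matrix.of_apply, Matrix.kroneckerMap_apply]
  ring

theorem trace_bipartiteTensor [Fintype a₁] [Fintype b₁] [Fintype a₂] [Fintype b₂]
    (ρ : Matrix (a₁ × b₁) (a₁ × b₁) ℂ) (σ : Matrix (a₂ × b₂) (a₂ × b₂) ℂ) :
    (bipartiteTensor ρ σ).trace = ρ.trace * σ.trace := by
  rw [← Matrix.trace_kronecker, bipartiteTensor_eq_submatrix]
  exact Fintype.sum_equiv (Equiv.prodProdProdComm a₁ a₂ b₁ b₂) _ _ fun _ => rfl

theorem posSemidef_bipartiteTensor [Fintype a₁] [Fintype b₁] [Fintype a₂] [Fintype b₂]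
    {ρ : Matrix (a₁ × b₁) (a₁ × b₁) ℂ} {σ : Matrix (a₂ × b₂) (a₂ × b₂) ℂ}
    (hρ : ρ.PosSemidef) (hσ : σ.PosSemidef) : (bipartiteTensor ρ σ).PosSemidef := by
  rw [bipartiteTensor_eq_submatrix]
  exact (hρ.kronecker hσ).submatrix _

end bipartiteTensor

/-! ### Local measurements -/

section Instrument

variable {a b a' b' : Type} [Fintype a] [DecidableEq a] [Fintype b] [DecidableEq b]
  [Fintype a'] [Fintype b'] {κ : Type} [DecidableEq κ]

/-- `IsLocalInstrument ρ ω`: local measurements of Alice and Bob turn `ρ` into the unnormalized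
states `ω k`. Alice has the Kraus operators `A x`, Bob has `B y`, and the pair `(x, y)` is
coarse-grained to the label `k = ℓ (x, y)`. -/
def IsLocalInstrument (ρ : Matrix (a × b) (a × b) ℂ) (ω : κ → Matrix (a' × b') (a' × b') ℂ) :
    Prop :=
  ∃ (X Y : Type) (_ : Fintype X) (_ : Fintype Y) (A : X → Matrix a' a ℂ) (B : Y → Matrix b' b ℂ)
    (ℓ : X × Y → κ), ∑ x, (A x)ᴴ * A x = 1 ∧ ∑ y, (B y)ᴴ * B y = 1 ∧
      ∀ k, ω k = ∑ z with ℓ z = k, (A z.1 ⊗ₖ B z.2) * ρ * (A z.1 ⊗ₖ B z.2)ᴴ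

variable {ρ : Matrix (a × b) (a × b) ℂ} {ω : κ → Matrix (a' × b') (a' × b') ℂ}

theorem IsLocalInstrument.posSemidef (h : IsLocalInstrument ρ ω) (hρ : ρ.PosSemidef) (k : κ) :
    (ω k).PosSemidef := by
  obtain ⟨X, Y, _, _, A, B, ℓ, hA, hB, hω⟩ := h
  rw [hω]
  exact Matrix.posSemidef_sum _ fun z _ => hρ.mul_mul_conjTranspose_same _

theorem IsLocalInstrument.sum_trace [Fintype κ] (h : IsLocalInstrument ρ ω) :
    ∑ k, (ω k).trace = ρ.trace := by
  obtain ⟨X, Y, _, _, A, B, ℓ, hA, hB, hω⟩ := h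
  have h1 : ∑ z : X × Y, (A z.1 ⊗ₖ B z.2)ᴴ * (A z.1 ⊗ₖ B z.2) = 1 := by
    simp only [Matrix.conjTranspose_kronecker, ← Matrix.mul_kronecker_mul, Fintype.sum_prod_type]
    have (S : X → Matrix a a ℂ) (T : Y → Matrix b b ℂ) :
        ∑ x, ∑ y, S x ⊗ₖ T y = (∑ x, S x) ⊗ₖ (∑ y, T y) := by
      ext p q
      simp only [Matrix.sum_apply, Matrix.kroneckerMap_apply, Finset.sum_mul_sum]
    rw [this fun x => (A x)ᴴ * A x, hA, hB, Matrix.one_kronecker_one]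
  simp only [hω, Matrix.trace_sum]
  rw [Finset.sum_fiberwise]
  simp only [Matrix.mul_assoc, Matrix.trace_mul_comm (A _ ⊗ₖ B _)]
  rw [← Matrix.trace_sum, ← Matrix.mul_sum, h1, Matrix.mul_one]

/-- Measuring each of many copies is a local measurement, with strings of labels as labels. -/
theorem IsLocalInstrument.pow {τ : Type} [Fintype τ] [DecidableEq τ]
    (h : IsLocalInstrument ρ ω) :
    IsLocalInstrument (localTensor fun _ : τ => ρ)
      (fun s : τ → κ => localTensor fun t => ω (s t)) := by
  obtain ⟨X, Y, _, _, A, B, ℓ, hA, hB, hω⟩ := h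
  have complete {Z r s : Type} [Fintype Z] [Fintype r] [Fintype s] [DecidableEq s]
      (C : Z → Matrix r s ℂ) (hC : ∑ z, (C z)ᴴ * C z = 1) :
      ∑ z : τ → Z, (piTensor fun t => C (z t))ᴴ * piTensor (fun t => C (z t)) = 1 := by
    simp only [piTensor_conjTranspose, piTensor_mul]
    have := sum_piTensor (τ := τ) (fun _ => (Finset.univ : Finset Z)) (fun _ z => (C z)ᴴ * C z)
    rw [Fintype.piFinset_univ] at this
    rw [this, hC, piTensor_one]
  refine ⟨τ → X, τ → Y, inferInstance, inferInstance, fun x => piTensor fun t => A (x t),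
    fun y => piTensor fun t => B (y t), fun z t => ℓ (z.1 t, z.2 t), complete A hA, complete B hB,
    fun s => ?_⟩
  simp only [← localTensor_kronecker, localTensor_conjTranspose, localTensor_mul, hω]
  rw [← sum_localTensor (fun t => Finset.univ.filter fun z => ℓ z = s t)
    (fun _ z => (A z.1 ⊗ₖ B z.2) * ρ * (A z.1 ⊗ₖ B z.2)ᴴ)]
  refine Finset.sum_equiv (Equiv.arrowProdEquivProdArrow τ _ _) (fun z => ?_) fun z _ => rfl
  simp [Fintype.mem_piFinset, funext_iff]

end Instrument

/-! ### Attainable overlaps -/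

/-- Some LOCC operation takes `ρ` to an operator whose overlap with the maximally entangled state
of dimension `M` is exactly `z`. -/
def Attains {a b : Type} [Fintype a] [DecidableEq a] [Fintype b] [DecidableEq b]
    (ρ : Matrix (a × b) (a × b) ℂ) (M : ℕ) (z : ℂ) : Prop :=
  ∃ V : Matrix (a × b) (a × b) ℂ → Matrix (Fin M × Fin M) (Fin M × Fin M) ℂ,
    IsLOCC V ∧ maxEntOverlap (V ρ) = z

section Attains

variable {a b a' b' : Type} [Fintype a] [DecidableEq a] [Fintype b] [DecidableEq b]
  [Fintype a'] [DecidableEq a'] [Fintype b'] [DecidableEq b']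
  {ρ : Matrix (a × b) (a × b) ℂ} {M : ℕ} {z : ℂ}

theorem Attains.nonneg (h : Attains ρ M z) (hρ : ρ.PosSemidef) : 0 ≤ z := by
  obtain ⟨V, hV, rfl⟩ := h
  exact (hV.posSemidef hρ).dotProduct_mulVec_nonneg _

theorem Attains.smul (h : Attains ρ M z) (w : ℂ) : Attains (w • ρ) M (w * z) := by
  obtain ⟨V, hV, rfl⟩ := h
  exact ⟨V, hV, by rw [hV.isLinearMap.map_smul, maxEntOverlap_smul]⟩

theorem Attains.alice {κ : Type} [Fintype κ] {S : κ → Type} [∀ x, Fintype (S x)]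
    [∀ x, DecidableEq (S x)] {K : ∀ x, Matrix (S x) a ℂ} (hK : ∑ x, (K x)ᴴ * K x = 1) {z : κ → ℂ}
    (h : ∀ x, Attains ((K x ⊗ₖ (1 : Matrix b b ℂ)) * ρ * (K x ⊗ₖ (1 : Matrix b b ℂ))ᴴ) M (z x)) :
    Attains ρ M (∑ x, z x) := by
  choose V hV hz using h
  exact ⟨_, IsLOCC.alice S K hK V hV, by rw [maxEntOverlap_sum]; simp only [hz]⟩

theorem Attains.bob {κ : Type} [Fintype κ] {S : κ → Type} [∀ x, Fintype (S x)]
    [∀ x, DecidableEq (S x)] {K : ∀ x, Matrix (S x) b ℂ} (hK : ∑ x, (K x)ᴴ * K x = 1) {z : κ → ℂ}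
    (h : ∀ x, Attains (((1 : Matrix a a ℂ) ⊗ₖ K x) * ρ * ((1 : Matrix a a ℂ) ⊗ₖ K x)ᴴ) M (z x)) :
    Attains ρ M (∑ x, z x) := by
  choose V hV hz using h
  exact ⟨_, IsLOCC.bob S K hK V hV, by rw [maxEntOverlap_sum]; simp only [hz]⟩

/-- After a local measurement, Alice and Bob may choose their protocol according to the label of
the outcome. By linearity, only the coarse-grained states `ω k` matter. -/
theorem IsLocalInstrument.attains {κ : Type} [Fintype κ] [DecidableEq κ]
    {ω : κ → Matrix (a' × b') (a' × b') ℂ}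
    (h : IsLocalInstrument ρ ω) {z : κ → ℂ} (hz : ∀ k, Attains (ω k) M (z k)) :
    Attains ρ M (∑ k, z k) := by
  obtain ⟨X, Y, _, _, A, B, ℓ, hA, hB, hω⟩ := h
  choose V hV hz using hz
  have key : ∑ k, z k = ∑ x, ∑ y,
      maxEntOverlap (V (ℓ (x, y)) ((A x ⊗ₖ B y) * ρ * (A x ⊗ₖ B y)ᴴ)) := by
    rw [← Fintype.sum_prod_type', ← Finset.sum_fiberwise _ ℓ]
    refine Finset.sum_congr rfl fun k _ => ?_
    rw [← hz, hω, ← (hV k).isLinearMap.mk'_apply, map_sum, maxEntOverlap_sum]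
    refine Finset.sum_congr rfl fun x hx => ?_
    rw [Finset.mem_filter] at hx
    simp [← hx.2]
  rw [key]
  refine Attains.alice hA fun x => Attains.bob hB fun y => ⟨V (ℓ (x, y)), hV _, ?_⟩
  have e : A x ⊗ₖ B y = ((1 : Matrix a' a' ℂ) ⊗ₖ B y) * (A x ⊗ₖ (1 : Matrix b b ℂ)) := by
    rw [← Matrix.mul_kronecker_mul, Matrix.one_mul, Matrix.mul_one]
  rw [e, Matrix.conjTranspose_mul]
  simp only [Matrix.mul_assoc]

/-- Local relabellings of the bases. -/
theorem isLocalInstrument_submatrix (ρ : Matrix (a × b) (a × b) ℂ) (e : a' ≃ a) (f : b' ≃ b) :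
    IsLocalInstrument (ρ.submatrix (Prod.map e f) (Prod.map e f)) (fun _ : Unit => ρ) := by
  have iso {r s : Type} [Fintype r] [DecidableEq r] [Fintype s] [DecidableEq s] (e : s ≃ r) :
      ∑ _x : Unit, ((1 : Matrix r r ℂ).submatrix id e)ᴴ * (1 : Matrix r r ℂ).submatrix id e = 1 := by
    simp only [Finset.univ_unique, Finset.sum_singleton, Matrix.conjTranspose_submatrix,
      Matrix.conjTranspose_one]
    rw [← Matrix.submatrix_mul _ _ e id e Function.bijective_id, Matrix.one_mul,
      Matrix.submatrix_one_equiv]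
  have hk : ((1 : Matrix a a ℂ).submatrix id e) ⊗ₖ ((1 : Matrix b b ℂ).submatrix id f) =
      (1 : Matrix (a × b) (a × b) ℂ).submatrix id (e.prodCongr f) := by
    ext p q
    by_cases h1 : p.1 = e q.1 <;> by_cases h2 : p.2 = f q.2 <;>
      simp [Matrix.kroneckerMap_apply, Matrix.one_apply, Prod.ext_iff, h1, h2]
  refine ⟨Unit, Unit, inferInstance, inferInstance, fun _ => (1 : Matrix a a ℂ).submatrix id e,
    fun _ => (1 : Matrix b b ℂ).submatrix id f, fun _ => (), iso e, iso f, fun _ => ?_⟩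
  have hc : Prod.map e f = e.prodCongr f := rfl
  simp only [hk, hc, Finset.filter_true]
  rw [Matrix.one_submatrix_mul, Matrix.conjTranspose_submatrix, Matrix.conjTranspose_one,
    Matrix.mul_submatrix_one]
  ext p q
  simp [Prod.map]

theorem Attains.submatrix (h : Attains ρ M z) (e : a' ≃ a) (f : b' ≃ b) :
    Attains (ρ.submatrix (Prod.map e f) (Prod.map e f)) M z := by
  simpa using (isLocalInstrument_submatrix ρ e f).attains (z := fun _ => z) fun _ => h

/-- Discarding everything and preparing a product state leaves the overlap `1 / M`. -/
theorem attains_trace_div (ρ : Matrix (a × b) (a × b) ℂ) (hM : M ≠ 0) :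
    Attains ρ M (ρ.trace / M) := by
  have : NeZero M := ⟨hM⟩
  have complete (r : Type) [Fintype r] [DecidableEq r] :
      ∑ x : r, (Matrix.single (0 : Fin M) x (1 : ℂ))ᴴ * Matrix.single (0 : Fin M) x (1 : ℂ) = 1 := by
    simp only [Matrix.conjTranspose_single, star_one, Matrix.single_mul_single_same, mul_one]
    exact Matrix.sum_single_one
  have hinst : IsLocalInstrument ρ fun _ : Unit =>
      ρ.trace • Matrix.single ((0 : Fin M), (0 : Fin M)) ((0 : Fin M), (0 : Fin M)) (1 : ℂ) := by
    refine ⟨a, b, inferInstance, inferInstance, _, _, fun _ => (), complete a, complete b,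
      fun _ => ?_⟩
    simp only [Matrix.single_kronecker_single, Matrix.conjTranspose_single, mul_one, star_one,
      Finset.filter_true, Matrix.single_mul_mul_single, one_mul]
    ext p q
    simp [Matrix.sum_apply, Matrix.single_apply, Matrix.trace]
  have := hinst.attains (M := M) (z := fun _ => ρ.trace / M) fun _ => ⟨_, IsLOCC.done, ?_⟩
  · simpa using this
  · rw [maxEntOverlap_smul, maxEntOverlap_eq_sum]
    simp [Matrix.single_apply, Prod.ext_iff, div_eq_mul_inv, ite_and]

theorem attains_trace (ρ : Matrix (a × b) (a × b) ℂ) : Attains ρ 1 ρ.trace := by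
  simpa using attains_trace_div ρ one_ne_zero

end Attains

/-! ### Protocols on tensor products -/

section Tensor

variable {a b c d : Type} [Fintype a] [DecidableEq a] [Fintype b] [DecidableEq b]
  [Fintype c] [DecidableEq c] [Fintype d] [DecidableEq d]

/-- Running an LOCC operation `V` on the first tensor factor, with the second one `σ` held aside:
what `base` attains after `V` is attained before it. -/
theorem IsLOCC.attains_bipartiteTensor {a' b' : Type} [Fintype a'] [DecidableEq a'] [Fintype b']
    [DecidableEq b'] {σ : Matrix (c × d) (c × d) ℂ} {L : ℕ}
    {f : Matrix (a' × b') (a' × b') ℂ → ℂ} (hf : IsLinearMap ℂ f)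
    (base : ∀ ρ : Matrix (a' × b') (a' × b') ℂ, Attains (bipartiteTensor ρ σ) L (f ρ))
    {V : Matrix (a × b) (a × b) ℂ → Matrix (a' × b') (a' × b') ℂ} (hV : IsLOCC V)
    (ρ : Matrix (a × b) (a × b) ℂ) : Attains (bipartiteTensor ρ σ) L (f (V ρ)) := by
  induction hV with
  | done => exact base ρ
  | @alice a b _ _ _ _ κ _ S _ _ K hK V hV ih =>
    have hK' : ∑ x, (K x ⊗ₖ (1 : Matrix c c ℂ))ᴴ * (K x ⊗ₖ (1 : Matrix c c ℂ)) = 1 := by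
      simp only [Matrix.conjTranspose_kronecker, ← Matrix.mul_kronecker_mul,
        Matrix.conjTranspose_one, Matrix.mul_one]
      rw [← Matrix.one_kronecker_one, ← hK]
      ext p q
      simp only [Matrix.sum_apply, Matrix.kroneckerMap_apply, Finset.sum_mul]
    have := Attains.alice (ρ := bipartiteTensor ρ σ) (M := L) hK' fun x => by
      have h := ih x ((K x ⊗ₖ (1 : Matrix b b ℂ)) * ρ * (K x ⊗ₖ (1 : Matrix b b ℂ))ᴴ)
      rwa [← Matrix.one_kronecker_one, ← bipartiteTensor_kronecker, bipartiteTensor_conjTranspose,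
        bipartiteTensor_mul, bipartiteTensor_mul, Matrix.one_kronecker_one, Matrix.one_mul,
        Matrix.conjTranspose_one, Matrix.mul_one]
    rwa [← hf.mk'_apply, map_sum]
  | @bob a b _ _ _ _ κ _ S _ _ K hK V hV ih =>
    have hK' : ∑ x, (K x ⊗ₖ (1 : Matrix d d ℂ))ᴴ * (K x ⊗ₖ (1 : Matrix d d ℂ)) = 1 := by
      simp only [Matrix.conjTranspose_kronecker, ← Matrix.mul_kronecker_mul,
        Matrix.conjTranspose_one, Matrix.mul_one]
      rw [← Matrix.one_kronecker_one, ← hK]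
      ext p q
      simp only [Matrix.sum_apply, Matrix.kroneckerMap_apply, Finset.sum_mul]
    have := Attains.bob (ρ := bipartiteTensor ρ σ) (M := L) hK' fun x => by
      have h := ih x (((1 : Matrix a a ℂ) ⊗ₖ K x) * ρ * ((1 : Matrix a a ℂ) ⊗ₖ K x)ᴴ)
      rwa [← Matrix.one_kronecker_one, ← bipartiteTensor_kronecker, bipartiteTensor_conjTranspose,
        bipartiteTensor_mul, bipartiteTensor_mul, Matrix.one_kronecker_one, Matrix.one_mul,
        Matrix.conjTranspose_one, Matrix.mul_one]
    rwa [← hf.mk'_apply, map_sum]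

/-- Two maximally entangled states of dimensions `M` and `N` form one of dimension `M N`. -/
theorem attains_bipartiteTensor_maxEntOverlap {M N : ℕ}
    (ρ : Matrix (Fin M × Fin M) (Fin M × Fin M) ℂ)
    (σ : Matrix (Fin N × Fin N) (Fin N × Fin N) ℂ) :
    Attains (bipartiteTensor ρ σ) (M * N) (maxEntOverlap ρ * maxEntOverlap σ) := by
  let e := (finProdFinEquiv (m := M) (n := N))
  have h : Attains ((bipartiteTensor ρ σ).submatrix (Prod.map e.symm e.symm)
      (Prod.map e.symm e.symm)) (M * N) (maxEntOverlap ρ * maxEntOverlap σ) := by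
    refine ⟨_, IsLOCC.done, ?_⟩
    have sum_e (f : Fin (M * N) → ℂ) : ∑ i, f i = ∑ i, ∑ j, f (e (i, j)) := by
      rw [← e.sum_comp, Fintype.sum_prod_type]
    simp only [maxEntOverlap_eq_sum, sum_e, Matrix.submatrix_apply, Prod.map_apply,
      Equiv.symm_apply_apply, bipartiteTensor, Matrix.of_apply]
    rw [mul_mul_mul_comm, ← mul_inv, ← Nat.cast_mul, Finset.sum_mul_sum]
    simp only [Finset.sum_mul_sum]
  convert h.submatrix e e using 1
  ext p q
  simp [Prod.map]

/-- Two protocols run in parallel; overlaps multiply. -/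
theorem Attains.tensor {ρ : Matrix (a × b) (a × b) ℂ} {σ : Matrix (c × d) (c × d) ℂ} {M N : ℕ}
    {z w : ℂ} (hρ : Attains ρ M z) (hσ : Attains σ N w) :
    Attains (bipartiteTensor ρ σ) (M * N) (z * w) := by
  obtain ⟨V, hV, rfl⟩ := hρ
  obtain ⟨W, hW, rfl⟩ := hσ
  have lin (w : ℂ) (M : ℕ) : IsLinearMap ℂ fun ρ => maxEntOverlap (M := M) ρ * w :=
    ⟨fun ρ σ => by simp only [maxEntOverlap_add, add_mul],
      fun z ρ => by simp only [maxEntOverlap_smul, smul_eq_mul, mul_assoc]⟩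
  refine hV.attains_bipartiteTensor (lin _ M) (fun ρ => ?_) ρ
  have swap {a b c d : Type} [Fintype a] [DecidableEq a] [Fintype b] [DecidableEq b]
      [Fintype c] [DecidableEq c] [Fintype d] [DecidableEq d] {ρ : Matrix (a × b) (a × b) ℂ}
      {σ : Matrix (c × d) (c × d) ℂ} {L : ℕ} {z : ℂ} (h : Attains (bipartiteTensor σ ρ) L z) :
      Attains (bipartiteTensor ρ σ) L z := by
    convert h.submatrix (Equiv.prodComm a c) (Equiv.prodComm b d) using 1
    ext p q
    simp [bipartiteTensor, mul_comm]
  suffices h : Attains (bipartiteTensor σ ρ) (M * N) (maxEntOverlap (W σ) * maxEntOverlap ρ) by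
    rw [mul_comm (maxEntOverlap ρ)]
    exact swap h
  refine hW.attains_bipartiteTensor (lin (maxEntOverlap ρ) N) (fun σ => ?_) σ
  rw [mul_comm (maxEntOverlap σ)]
  exact swap (attains_bipartiteTensor_maxEntOverlap ρ σ)

/-- A tensor product over the disjoint union of two families is processed family by family. -/
theorem Attains.localTensor {τ τ₁ τ₂ : Type} [Fintype τ] [DecidableEq τ] [Fintype τ₁]
    [DecidableEq τ₁] [Fintype τ₂] [DecidableEq τ₂] {ω : τ → Matrix (a × b) (a × b) ℂ}
    {ω₁ : τ₁ → Matrix (a × b) (a × b) ℂ} {ω₂ : τ₂ → Matrix (a × b) (a × b) ℂ} {M N : ℕ} {z w : ℂ}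
    (e : τ₁ ⊕ τ₂ ≃ τ) (h₁ : ∀ t, ω (e (.inl t)) = ω₁ t) (h₂ : ∀ t, ω (e (.inr t)) = ω₂ t)
    (hz : Attains (localTensor ω₁) M z) (hw : Attains (localTensor ω₂) N w) :
    Attains (localTensor ω) (M * N) (z * w) := by
  convert (hz.tensor hw).submatrix
    ((e.symm.arrowCongr (Equiv.refl a)).trans (Equiv.sumArrowEquivProdArrow τ₁ τ₂ a))
    ((e.symm.arrowCongr (Equiv.refl b)).trans (Equiv.sumArrowEquivProdArrow τ₁ τ₂ b)) using 1
  ext p q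
  simp only [AssistedDistillation.localTensor, bipartiteTensor, Matrix.of_apply,
    Matrix.submatrix_apply]
  rw [← e.prod_comp, Fintype.prod_sum_type]
  simp only [h₁, h₂]
  rfl

theorem attains_localTensor_of_isEmpty {τ : Type} [Fintype τ] [DecidableEq τ] [IsEmpty τ]
    (ω : τ → Matrix (a × b) (a × b) ℂ) : Attains (localTensor ω) 1 1 := by
  simpa [trace_localTensor] using attains_trace (localTensor ω)

/-- Surplus copies are discarded. -/
theorem Attains.localTensor_const {ρ : Matrix (a × b) (a × b) ℂ} {M : ℕ} {z : ℂ}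
    {τ₀ τ : Type} [Fintype τ₀] [DecidableEq τ₀] [Fintype τ] [DecidableEq τ]
    (h : Attains (AssistedDistillation.localTensor fun _ : τ₀ => ρ) M z)
    (hτ : Fintype.card τ₀ ≤ Fintype.card τ) :
    Attains (AssistedDistillation.localTensor fun _ : τ => ρ) M
      (z * ρ.trace ^ (Fintype.card τ - Fintype.card τ₀)) := by
  have e : τ₀ ⊕ Fin (Fintype.card τ - Fintype.card τ₀) ≃ τ :=
    Fintype.equivOfCardEq (by simp [Nat.add_sub_cancel' hτ])
  have h2 := attains_trace
    (AssistedDistillation.localTensor fun _ : Fin (Fintype.card τ - Fintype.card τ₀) => ρ)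
  rw [trace_localTensor] at h2
  simpa using h.localTensor (ω := fun _ => ρ) e (fun _ => rfl) (fun _ => rfl) h2

end Tensor

/-! ### Achievable rates -/

section Rates

variable {a b c d : Type} [Fintype a] [DecidableEq a] [Fintype b] [DecidableEq b]
  [Fintype c] [DecidableEq c] [Fintype d] [DecidableEq d]

/-- Achievability in terms of attainable overlaps. -/
theorem isAchievableRate_iff {ρ : Matrix (a × b) (a × b) ℂ} (hρ : ρ.PosSemidef) (R : ℝ≥0) :
    IsAchievableRate ρ R ↔ ∃ (M : ℕ → ℕ) (ε : ℕ → ℝ), Tendsto ε atTop (𝓝 0) ∧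
      Tendsto (fun n : ℕ => (1 / (n : ℝ)) * Real.logb 2 (M n)) atTop (𝓝 (R : ℝ)) ∧
      ∀ᶠ n : ℕ in atTop, ∃ z : ℂ,
        Attains (localTensor fun _ : Fin n => ρ) (M n) z ∧ 1 - ε n ≤ z.re := by
  refine exists_congr fun M => exists_congr fun ε => and_congr_right fun _ => and_congr_right
    fun _ => eventually_congr (Eventually.of_forall fun n => ?_)
  have hn : (bipartitePower ρ n).PosSemidef := posSemidef_localTensor fun _ => hρ
  constructor
  · rintro ⟨V, hV, h⟩
    exact ⟨_, ⟨V, hV, rfl⟩, h.trans_eq (fidelity_maxEnt_sq (hV.posSemidef hn))⟩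
  · rintro ⟨z, ⟨V, hV, rfl⟩, h⟩
    exact ⟨V, hV, h.trans_eq (fidelity_maxEnt_sq (hV.posSemidef hn)).symm⟩

/-- A nonzero overlap rules out the degenerate target `M = 0`. -/
theorem Attains.dim_ne_zero {ρ : Matrix (a × b) (a × b) ℂ} {M : ℕ} {z : ℂ} (h : Attains ρ M z)
    (hz : z ≠ 0) : M ≠ 0 := by
  rintro rfl
  obtain ⟨V, -, rfl⟩ := h
  exact hz (by simp [maxEntOverlap, dotProduct])

theorem isAchievableRate_zero {ρ : Matrix (a × b) (a × b) ℂ} (hρ : IsState ρ) :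
    IsAchievableRate ρ 0 := by
  refine (isAchievableRate_iff hρ.1 0).mpr ⟨fun _ => 1, fun _ => 0, tendsto_const_nhds, by simp,
    Eventually.of_forall fun n => ⟨1, ?_, by simp⟩⟩
  simpa [trace_localTensor, hρ.2] using attains_trace (localTensor fun _ : Fin n => ρ)

theorem IsAchievableRate.le_distillable {ρ : Matrix (a × b) (a × b) ℂ} {R : ℝ≥0}
    (h : IsAchievableRate ρ R) : (R : ℝ≥0∞) ≤ distillable ρ :=
  le_iSup₂_of_le R h le_rfl

theorem IsAchievableRate.submatrix {ρ : Matrix (a × b) (a × b) ℂ} {R : ℝ≥0}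
    (h : IsAchievableRate ρ R) (hρ : ρ.PosSemidef) (e : c ≃ a) (f : d ≃ b) :
    IsAchievableRate (ρ.submatrix (Prod.map e f) (Prod.map e f)) R := by
  obtain ⟨M, ε, hε, hM, hV⟩ := (isAchievableRate_iff hρ R).mp h
  refine (isAchievableRate_iff (hρ.submatrix _) R).mpr ⟨M, ε, hε, hM, hV.mono fun n => ?_⟩
  rintro ⟨z, hz, hle⟩
  exact ⟨z, hz.submatrix ((Equiv.refl _).arrowCongr e) ((Equiv.refl _).arrowCongr f), hle⟩

theorem distillable_le_submatrix {ρ : Matrix (a × b) (a × b) ℂ} (hρ : ρ.PosSemidef)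
    (e : c ≃ a) (f : d ≃ b) :
    distillable ρ ≤ distillable (ρ.submatrix (Prod.map e f) (Prod.map e f)) :=
  iSup₂_le fun _ h => (h.submatrix hρ e f).le_distillable

theorem IsAchievableRate.tensor {ρ : Matrix (a × b) (a × b) ℂ} {σ : Matrix (c × d) (c × d) ℂ}
    {R S : ℝ≥0} (hR : IsAchievableRate ρ R) (hS : IsAchievableRate σ S) (hρ : ρ.PosSemidef)
    (hσ : σ.PosSemidef) : IsAchievableRate (bipartiteTensor ρ σ) (R + S) := by
  obtain ⟨M, ε, hε, hM, hV⟩ := (isAchievableRate_iff hρ R).mp hR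
  obtain ⟨N, δ, hδ, hN, hW⟩ := (isAchievableRate_iff hσ S).mp hS
  have key : ∀ᶠ n : ℕ in atTop, M n ≠ 0 ∧ N n ≠ 0 ∧ ∃ z : ℂ,
      Attains (localTensor fun _ : Fin n => bipartiteTensor ρ σ) (M n * N n) z ∧
        (1 - ε n) * (1 - δ n) ≤ z.re := by
    filter_upwards [hV, hW, hε.eventually_lt_const one_pos, hδ.eventually_lt_const one_pos]
    rintro n ⟨z, hz, hzε⟩ ⟨w, hw, hwδ⟩ hε1 hδ1
    have hz0 : 0 < z.re := by linarith
    have hw0 : 0 < w.re := by linarith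
    refine ⟨hz.dim_ne_zero fun h => by simp [h] at hz0,
      hw.dim_ne_zero fun h => by simp [h] at hw0, z * w, ?_, ?_⟩
    · convert (hz.tensor hw).submatrix (Equiv.arrowProdEquivProdArrow (Fin n) (fun _ => a) fun _ => c)
        (Equiv.arrowProdEquivProdArrow (Fin n) (fun _ => b) fun _ => d) using 1
      ext p q
      simp [localTensor, bipartiteTensor, Finset.prod_mul_distrib]
    · have him : z.im = 0 :=
        (Complex.le_def.mp (hz.nonneg (posSemidef_localTensor fun _ => hρ))).2.symm
      rw [Complex.mul_re, him, zero_mul, sub_zero]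
      exact mul_le_mul hzε hwδ (by linarith) hz0.le
  refine (isAchievableRate_iff (posSemidef_bipartiteTensor hρ hσ) _).mpr
    ⟨fun n => M n * N n, fun n => 1 - (1 - ε n) * (1 - δ n), ?_, ?_, ?_⟩
  · simpa using ((hε.const_sub 1).mul (hδ.const_sub 1)).const_sub 1
  · rw [NNReal.coe_add]
    refine (hM.add hN).congr' ?_
    filter_upwards [key] with n ⟨hMn, hNn, _⟩
    rw [Nat.cast_mul, Real.logb_mul (by exact_mod_cast hMn) (by exact_mod_cast hNn), mul_add]
  · filter_upwards [key] with n ⟨_, _, z, hz, hle⟩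
    exact ⟨z, hz, by simpa using hle⟩

theorem distillable_add_le_tensor {ρ : Matrix (a × b) (a × b) ℂ} {σ : Matrix (c × d) (c × d) ℂ}
    (hρ : IsState ρ) (hσ : IsState σ) :
    distillable ρ + distillable σ ≤ distillable (bipartiteTensor ρ σ) :=
  ENNReal.biSup_add_biSup_le' ⟨0, isAchievableRate_zero hρ⟩ ⟨0, isAchievableRate_zero hσ⟩
    fun R hR S hS => by simpa using (hR.tensor hS hρ.1 hσ.1).le_distillable

/-- If `M` grows at the rate `R` and `L n ~ p n`, then `M ∘ L` grows at the rate `p R`. -/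
theorem tendsto_logb_comp {M L : ℕ → ℕ} {R p : ℝ}
    (hM : Tendsto (fun n : ℕ => (1 / (n : ℝ)) * Real.logb 2 (M n)) atTop (𝓝 R))
    (hL : Tendsto L atTop atTop) (hp : Tendsto (fun n : ℕ => (L n : ℝ) / n) atTop (𝓝 p)) :
    Tendsto (fun n : ℕ => (1 / (n : ℝ)) * Real.logb 2 (M (L n))) atTop (𝓝 (p * R)) := by
  refine (hp.mul (hM.comp hL)).congr' ?_
  filter_upwards [hL.eventually_gt_atTop 0] with n hn
  have : (L n : ℝ) ≠ 0 := by positivity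
  simp only [Function.comp_apply]
  field_simp

/-- Distilling `⌊N / n⌋` blocks of `n` copies is a way to distil `N` copies. -/
theorem IsAchievableRate.of_bipartitePower {ρ : Matrix (a × b) (a × b) ℂ} (hρ : IsState ρ) {n : ℕ}
    (hn : n ≠ 0) {R : ℝ≥0} (h : IsAchievableRate (bipartitePower ρ n) R) :
    IsAchievableRate ρ ((n : ℝ≥0)⁻¹ * R) := by
  obtain ⟨M, ε, hε, hM, hV⟩ := (isAchievableRate_iff (posSemidef_localTensor fun _ => hρ.1) R).mp h
  have hL : Tendsto (fun N => N / n) atTop atTop := Nat.tendsto_div_const_atTop hn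
  refine (isAchievableRate_iff hρ.1 _).mpr
    ⟨fun N => M (N / n), fun N => ε (N / n), hε.comp hL, ?_, ?_⟩
  · have := tendsto_logb_comp hM hL (p := (n : ℝ)⁻¹) ?_
    · simpa using this
    · have := (tendsto_nat_floor_mul_div_atTop (R := ℝ) (a := (n : ℝ)⁻¹) (by positivity)).comp
        tendsto_natCast_atTop_atTop
      refine this.congr fun N => ?_
      simp only [Function.comp_apply]
      rw [inv_mul_eq_div, Nat.floor_div_eq_div]
  · filter_upwards [hL.eventually hV] with N hN
    obtain ⟨z, hz, hle⟩ := hN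
    have h1 : Attains (localTensor fun _ : Fin (N / n) × Fin n => ρ) (M (N / n)) z := by
      convert hz.submatrix (Equiv.curry (Fin (N / n)) (Fin n) a)
        (Equiv.curry (Fin (N / n)) (Fin n) b) using 1
      ext p q
      simp [localTensor, Fintype.prod_prod_type, Function.curry]
    have h2 := h1.localTensor_const (τ := Fin N) (by simpa using Nat.div_mul_le_self N n)
    rw [hρ.2, one_pow, mul_one] at h2
    exact ⟨z, h2, hle⟩

theorem distillable_bipartitePower_le {ρ : Matrix (a × b) (a × b) ℂ} (hρ : IsState ρ) {n : ℕ}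
    (hn : n ≠ 0) : distillable (bipartitePower ρ n) ≤ n * distillable ρ := by
  refine iSup₂_le fun R hR => ?_
  have hR' : R = n * ((n : ℝ≥0)⁻¹ * R) := by
    rw [mul_inv_cancel_left₀ (by exact_mod_cast hn)]
  rw [hR', ENNReal.coe_mul, ENNReal.coe_natCast]
  exact mul_le_mul_right (hR.of_bipartitePower hρ hn).le_distillable _

end Rates

/-! ### Outcome frequencies in independent trials -/

section Frequencies

variable {κ : Type} [Fintype κ]

/-- Mean and variance of the sum of `N` independent copies of a centred random variable `f`. -/
theorem sum_prod_mul_sum_sq {p f : κ → ℝ} (hp : ∑ k, p k = 1) (hf : ∑ k, p k * f k = 0) (N : ℕ) :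
    ∑ s : Fin N → κ, ∏ t, p (s t) = 1 ∧
    ∑ s : Fin N → κ, (∏ t, p (s t)) * ∑ t, f (s t) = 0 ∧
    ∑ s : Fin N → κ, (∏ t, p (s t)) * (∑ t, f (s t)) ^ 2 = N * ∑ k, p k * f k ^ 2 := by
  have split (N : ℕ) (g : (Fin (N + 1) → κ) → ℝ) :
      ∑ s, g s = ∑ k, ∑ s : Fin N → κ, g (Fin.cons k s) := by
    rw [← (Fin.consEquiv fun _ => κ).sum_comp, Fintype.sum_prod_type]
    rfl
  induction N with
  | zero => simp
  | succ N ih =>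
    obtain ⟨h0, h1, h2⟩ := ih
    simp only [split, Fin.prod_univ_succ, Fin.sum_univ_succ, Fin.cons_zero, Fin.cons_succ]
    refine ⟨?_, ?_, ?_⟩
    · simp only [← Finset.mul_sum, h0, mul_one, hp]
    · have (k : κ) : ∑ s : Fin N → κ, p k * (∏ t, p (s t)) * (f k + ∑ t, f (s t)) = p k * f k := by
        have e (s : Fin N → κ) : p k * (∏ t, p (s t)) * (f k + ∑ t, f (s t)) =
            p k * f k * (∏ t, p (s t)) + p k * ((∏ t, p (s t)) * ∑ t, f (s t)) := by ring
        simp only [e, Finset.sum_add_distrib, ← Finset.mul_sum, h0, h1]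
        ring
      simp only [this, hf]
    · have (k : κ) : ∑ s : Fin N → κ, p k * (∏ t, p (s t)) * (f k + ∑ t, f (s t)) ^ 2 =
          p k * f k ^ 2 + p k * (N * ∑ k, p k * f k ^ 2) := by
        have e (s : Fin N → κ) : p k * (∏ t, p (s t)) * (f k + ∑ t, f (s t)) ^ 2 =
            p k * f k ^ 2 * (∏ t, p (s t)) + 2 * p k * f k * ((∏ t, p (s t)) * ∑ t, f (s t)) +
              p k * ((∏ t, p (s t)) * (∑ t, f (s t)) ^ 2) := by ring
        simp only [e, Finset.sum_add_distrib, ← Finset.mul_sum, h0, h1, h2]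
        ring
      simp only [this, Finset.sum_add_distrib, ← Finset.sum_mul, hp]
      push_cast
      ring

theorem sum_prod_pow_eq_one {p : κ → ℝ} (hp : ∑ k, p k = 1) (N : ℕ) :
    ∑ s : Fin N → κ, ∏ t, p (s t) = 1 :=
  (sum_prod_mul_sum_sq (f := fun _ => 0) hp (by simp) N).1

/-- Chebyshev's inequality for the number of occurrences of one outcome. -/
theorem sum_prod_card_lt_le [DecidableEq κ] {p : κ → ℝ} (hp0 : ∀ k, 0 ≤ p k) (hp : ∑ k, p k = 1)
    (k : κ) (N : ℕ) {r : ℝ} (hr : 0 < r) :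
    ∑ s : Fin N → κ with (Fintype.card {t // s t = k} : ℝ) < N * p k - r, ∏ t, p (s t) ≤
      N / r ^ 2 := by
  set f : κ → ℝ := fun j => (if j = k then 1 else 0) - p k with hfdef
  have hf : ∑ j, p j * f j = 0 := by
    simp [hfdef, mul_sub, Finset.sum_sub_distrib, ← Finset.sum_mul, hp]
  have hf2 : ∑ j, p j * f j ^ 2 ≤ 1 := by
    have hk1 : p k ≤ 1 := hp ▸ Finset.single_le_sum (fun j _ => hp0 j) (Finset.mem_univ k)
    calc ∑ j, p j * f j ^ 2 ≤ ∑ j, p j * 1 := by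
          refine Finset.sum_le_sum fun j _ => mul_le_mul_of_nonneg_left ?_ (hp0 j)
          have := hp0 k
          by_cases h : j = k <;> simp only [hfdef, h, if_true, if_false] <;> nlinarith
      _ = 1 := by simpa using hp
  have hcount (s : Fin N → κ) : ∑ t, f (s t) = Fintype.card {t // s t = k} - N * p k := by
    simp [hfdef, Finset.sum_sub_distrib, Fintype.card_subtype]
  rw [le_div_iff₀ (by positivity), Finset.sum_mul]
  calc ∑ s : Fin N → κ with (Fintype.card {t // s t = k} : ℝ) < N * p k - r,
        (∏ t, p (s t)) * r ^ 2
      ≤ ∑ s : Fin N → κ with (Fintype.card {t // s t = k} : ℝ) < N * p k - r,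
        (∏ t, p (s t)) * (∑ t, f (s t)) ^ 2 := by
        refine Finset.sum_le_sum fun s hs => mul_le_mul_of_nonneg_left ?_
          (Finset.prod_nonneg fun t _ => hp0 _)
        rw [Finset.mem_filter] at hs
        rw [hcount]
        nlinarith [hs.2]
    _ ≤ ∑ s : Fin N → κ, (∏ t, p (s t)) * (∑ t, f (s t)) ^ 2 :=
        Finset.sum_le_sum_of_subset_of_nonneg (Finset.filter_subset _ _) fun s _ _ =>
          mul_nonneg (Finset.prod_nonneg fun t _ => hp0 _) (sq_nonneg _)
    _ = N * ∑ j, p j * f j ^ 2 := (sum_prod_mul_sum_sq hp hf N).2.2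
    _ ≤ N := mul_le_of_le_one_right (Nat.cast_nonneg N) hf2

/-- With high probability every outcome `k` occurs at least `⌊N p k - r⌋` times. -/
theorem le_sum_prod_typical [DecidableEq κ] {p : κ → ℝ} (hp0 : ∀ k, 0 ≤ p k) (hp : ∑ k, p k = 1)
    (N : ℕ) {r : ℝ} (hr : 0 < r) :
    1 - Fintype.card κ * (N / r ^ 2) ≤
      ∑ s : Fin N → κ with ∀ k, ⌊N * p k - r⌋₊ ≤ Fintype.card {t // s t = k}, ∏ t, p (s t) := by
  have hnn (s : Fin N → κ) : 0 ≤ ∏ t, p (s t) := Finset.prod_nonneg fun t _ => hp0 _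
  have hbad : ∑ s : Fin N → κ with ¬ ∀ k, ⌊N * p k - r⌋₊ ≤ Fintype.card {t // s t = k},
      ∏ t, p (s t) ≤ Fintype.card κ * (N / r ^ 2) := by
    calc _ ≤ ∑ k : κ, ∑ s : Fin N → κ with (Fintype.card {t // s t = k} : ℝ) < N * p k - r,
          ∏ t, p (s t) := by
          simp only [Finset.sum_filter]
          rw [Finset.sum_comm]
          refine Finset.sum_le_sum fun s _ => ?_
          have h0 (k : κ) : 0 ≤ if (Fintype.card {t // s t = k} : ℝ) < N * p k - r then
              ∏ t, p (s t) else 0 := by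
            split_ifs
            exacts [hnn s, le_rfl]
          split_ifs with h
          · exact Finset.sum_nonneg fun k _ => h0 k
          · simp only [not_forall, not_le] at h
            obtain ⟨k, hk⟩ := h
            refine le_trans ?_ (Finset.single_le_sum (fun k _ => h0 k) (Finset.mem_univ k))
            rw [if_pos (Nat.lt_of_lt_floor hk)]
      _ ≤ ∑ _k : κ, (N / r ^ 2 : ℝ) :=
          Finset.sum_le_sum fun k _ => sum_prod_card_lt_le hp0 hp k N hr
      _ = _ := by simp
  have := Finset.sum_filter_add_sum_filter_not (Finset.univ : Finset (Fin N → κ))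
    (fun s => ∀ k, ⌊N * p k - r⌋₊ ≤ Fintype.card {t // s t = k}) fun s => ∏ t, p (s t)
  rw [sum_prod_pow_eq_one hp] at this
  linarith

end Frequencies

/-! ### Distillable entanglement under local measurements -/

section Measurement

variable {a b a' b' : Type} [Fintype a] [DecidableEq a] [Fintype b] [DecidableEq b]
  [Fintype a'] [DecidableEq a'] [Fintype b'] [DecidableEq b'] {κ : Type} [Fintype κ]
  [DecidableEq κ]

/-- Distillation of the unnormalized state `ω` from any number of copies above `L N ~ N Tr ω`. At
`Tr ω = 0` the trivial protocol with `M = 1` is used. -/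
theorem exists_distillation_of_le_card {ω : Matrix (a × b) (a × b) ℂ} (hω : ω.PosSemidef) {R : ℝ≥0}
    (hR : ω.trace ≠ 0 → IsAchievableRate (ω.trace⁻¹ • ω) R) {L : ℕ → ℕ}
    (hL : Tendsto (fun N : ℕ => (L N : ℝ) / N) atTop (𝓝 ω.trace.re)) :
    ∃ (M : ℕ → ℕ) (ε : ℕ → ℝ), Tendsto ε atTop (𝓝 0) ∧
      Tendsto (fun N : ℕ => (1 / (N : ℝ)) * Real.logb 2 (M N)) atTop (𝓝 (ω.trace.re * R)) ∧
      ∀ᶠ N in atTop, ε N ≤ 1 ∧ M N ≠ 0 ∧ ∀ (τ : Type) [Fintype τ] [DecidableEq τ],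
        L N ≤ Fintype.card τ → ∃ z : ℂ, Attains (localTensor fun _ : τ => ω) (M N) z ∧
          ω.trace.re ^ Fintype.card τ * (1 - ε N) ≤ z.re := by
  obtain ⟨hre, him⟩ := Complex.le_def.mp hω.trace_nonneg
  have htr : ω.trace = (ω.trace.re : ℂ) := Complex.ext rfl (by simpa using him.symm)
  rcases eq_or_ne ω.trace 0 with h0 | h0
  · refine ⟨fun _ => 1, fun _ => 0, tendsto_const_nhds, by simp [h0], Eventually.of_forall
      fun N => ⟨zero_le_one, one_ne_zero, fun τ _ _ _ => ⟨_, attains_trace _, ?_⟩⟩⟩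
    simp [trace_localTensor, h0]
    norm_cast
  · have hpos : 0 < ω.trace.re := lt_of_le_of_ne hre fun h => h0 (by rw [htr, ← h]; simp)
    have hinv : 0 ≤ ω.trace⁻¹ := by
      rw [htr, ← Complex.ofReal_inv]
      exact_mod_cast (inv_pos.mpr hpos).le
    obtain ⟨M, ε, hε, hM, hV⟩ := (isAchievableRate_iff (hω.smul hinv) R).mp (hR h0)
    have hLtop : Tendsto L atTop atTop := by
      rw [← tendsto_natCast_atTop_iff (R := ℝ)]
      refine (hL.pos_mul_atTop hpos tendsto_natCast_atTop_atTop).congr' ?_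
      filter_upwards [eventually_gt_atTop 0] with N hN
      field_simp
    refine ⟨fun N => M (L N), fun N => ε (L N), hε.comp hLtop, tendsto_logb_comp hM hLtop hL, ?_⟩
    filter_upwards [hLtop.eventually hV, (hε.comp hLtop).eventually_lt_const one_pos] with N hN hε1
    obtain ⟨z, hz, hle⟩ := hN
    simp only [Function.comp_apply] at hε1
    refine ⟨hε1.le, hz.dim_ne_zero fun h => ?_, fun τ _ _ hτ => ?_⟩
    · rw [h, Complex.zero_re] at hle
      linarith
    · have h1 := (hz.localTensor_const (τ := τ) (by simpa using hτ)).smul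
        (ω.trace ^ Fintype.card τ)
      rw [← localTensor_smul, smul_smul, mul_inv_cancel₀ h0, one_smul, Matrix.trace_smul,
        smul_eq_mul, inv_mul_cancel₀ h0, one_pow, mul_one] at h1
      refine ⟨_, h1, ?_⟩
      rw [htr, ← Complex.ofReal_pow, Complex.re_ofReal_mul, Complex.ofReal_re]
      exact mul_le_mul_of_nonneg_left hle (by positivity)

/-- On a string `s` of outcomes in which every `k` occurs often enough, the copies of each `ω k` are
distilled separately. -/
theorem attains_localTensor_of_typical {ω : κ → Matrix (a × b) (a × b) ℂ}
    (hω : ∀ k, (ω k).PosSemidef) {L M : κ → ℕ} {p ε : κ → ℝ} (hp : ∀ k, 0 ≤ p k)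
    (hε : ∀ k, ε k ≤ 1)
    (h : ∀ k (τ : Type) [Fintype τ] [DecidableEq τ], L k ≤ Fintype.card τ →
      ∃ z : ℂ, Attains (localTensor fun _ : τ => ω k) (M k) z ∧
        p k ^ Fintype.card τ * (1 - ε k) ≤ z.re)
    {τ : Type} [Fintype τ] [DecidableEq τ] {s : τ → κ}
    (hs : ∀ k, L k ≤ Fintype.card {t // s t = k}) :
    ∃ z : ℂ, Attains (localTensor fun t => ω (s t)) (∏ k, M k) z ∧
      (∏ t, p (s t)) * ∏ k, (1 - ε k) ≤ z.re := by
  have key (S : Finset κ) : ∃ z : ℂ,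
      Attains (localTensor fun t : {t // s t ∈ S} => ω (s t)) (∏ k ∈ S, M k) z ∧
        (∏ t : {t // s t ∈ S}, p (s t)) * ∏ k ∈ S, (1 - ε k) ≤ z.re := by
    induction S using Finset.induction_on with
    | empty =>
      have : IsEmpty {t // s t ∈ (∅ : Finset κ)} := ⟨fun t => Finset.notMem_empty _ t.2⟩
      exact ⟨1, attains_localTensor_of_isEmpty _, by simp⟩
    | insert k S hk ih =>
      obtain ⟨w, hw, hwle⟩ := ih
      obtain ⟨z, hz, hzle⟩ := h k {t // s t = k} (hs k)
      have hdisj : Disjoint (fun t => s t = k) (fun t => s t ∈ S) := by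
        rw [Pi.disjoint_iff]
        intro t
        simp only [Prop.disjoint_iff]
        rintro ⟨rfl, h⟩
        exact hk h
      let e : {t // s t = k} ⊕ {t // s t ∈ S} ≃ {t // s t ∈ insert k S} :=
        (subtypeOrEquiv _ _ hdisj).symm.trans
          (Equiv.subtypeEquivRight fun t => Finset.mem_insert.symm)
      have hel (t : {t // s t = k}) : s (e (.inl t)) = k := t.2
      have her (t : {t // s t ∈ S}) : s (e (.inr t)) = s t := rfl
      refine ⟨z * w, ?_, ?_⟩
      · rw [Finset.prod_insert hk]
        exact Attains.localTensor e (fun t => by rw [hel]) (fun t => by rw [her]) hz hw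
      · rw [Finset.prod_insert hk, ← e.prod_comp, Fintype.prod_sum_type]
        simp only [hel, her, Finset.prod_const, Finset.card_univ]
        have hzim : z.im = 0 :=
          (Complex.le_def.mp (hz.nonneg (posSemidef_localTensor fun _ => hω k))).2.symm
        rw [Complex.mul_re, hzim, zero_mul, sub_zero, mul_mul_mul_comm]
        have h1 : 0 ≤ p k ^ Fintype.card {t // s t = k} * (1 - ε k) :=
          mul_nonneg (pow_nonneg (hp k) _) (sub_nonneg.mpr (hε k))
        have h2 : 0 ≤ (∏ t : {t // s t ∈ S}, p (s t)) * ∏ k ∈ S, (1 - ε k) :=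
          mul_nonneg (Finset.prod_nonneg fun _ _ => hp _)
            (Finset.prod_nonneg fun k _ => sub_nonneg.mpr (hε k))
        exact mul_le_mul hzle hwle h2 (h1.trans hzle)
  obtain ⟨z, hz, hle⟩ := key Finset.univ
  let e : τ ≃ {t // s t ∈ (Finset.univ : Finset κ)} :=
    (Equiv.subtypeUnivEquiv fun t => Finset.mem_univ _).symm
  refine ⟨z, ?_, ?_⟩
  · convert hz.submatrix (e.arrowCongr (Equiv.refl a)) (e.arrowCongr (Equiv.refl b)) using 1
    ext p q
    simp only [localTensor, Matrix.of_apply, Matrix.submatrix_apply]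
    rw [← e.prod_comp]
    simp [e, Prod.map]
  · rwa [← e.prod_comp] at hle

/-- Giving up `N δ N = o(N)` occurrences of an outcome does not change its frequency `p`; the floor
is `0` when `p = 0`. -/
theorem tendsto_floor_sub_div {p : ℝ} (hp : 0 ≤ p) {δ : ℕ → ℝ} (hδ0 : ∀ N, 0 ≤ δ N)
    (hδ : Tendsto δ atTop (𝓝 0)) :
    Tendsto (fun N : ℕ => (⌊N * p - N * δ N⌋₊ : ℝ) / N) atTop (𝓝 p) := by
  have hlow : Tendsto (fun N : ℕ => p - δ N - 1 / (N : ℝ)) atTop (𝓝 p) := by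
    simpa using (hδ.const_sub p).sub tendsto_one_div_atTop_nhds_zero_nat
  refine tendsto_of_tendsto_of_tendsto_of_le_of_le' hlow tendsto_const_nhds ?_ ?_
  · filter_upwards [eventually_gt_atTop 0] with N hN
    have hN' : (0 : ℝ) < N := by exact_mod_cast hN
    rw [le_div_iff₀ hN']
    have := (Nat.lt_floor_add_one ((N : ℝ) * p - N * δ N)).le
    have e : (p - δ N - 1 / (N : ℝ)) * N = N * p - N * δ N - 1 := by field_simp
    linarith
  · filter_upwards [eventually_gt_atTop 0] with N hN
    have hN' : (0 : ℝ) < N := by exact_mod_cast hN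
    rw [div_le_iff₀ hN']
    have : ⌊N * p - N * δ N⌋₊ ≤ ⌊N * p⌋₊ :=
      Nat.floor_le_floor (sub_le_self _ (mul_nonneg hN'.le (hδ0 N)))
    calc (⌊N * p - N * δ N⌋₊ : ℝ) ≤ ⌊N * p⌋₊ := by exact_mod_cast this
      _ ≤ N * p := Nat.floor_le (by positivity)
      _ = p * N := mul_comm _ _

/-- Distillation after a local measurement of each copy: rates average over the outcomes. -/
theorem IsLocalInstrument.isAchievableRate {ρ : Matrix (a × b) (a × b) ℂ}
    {ω : κ → Matrix (a' × b') (a' × b') ℂ} (h : IsLocalInstrument ρ ω) (hρ : IsState ρ)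
    {R : κ → ℝ≥0} (hR : ∀ k, (ω k).trace ≠ 0 → IsAchievableRate ((ω k).trace⁻¹ • ω k) (R k)) :
    IsAchievableRate ρ (∑ k, (ω k).trace.re.toNNReal * R k) := by
  have hω (k : κ) : (ω k).PosSemidef := h.posSemidef hρ.1 k
  have hp0 (k : κ) : 0 ≤ (ω k).trace.re := (Complex.le_def.mp (hω k).trace_nonneg).1
  have hp1 : ∑ k, (ω k).trace.re = 1 := by
    rw [← Complex.re_sum, h.sum_trace, hρ.2, Complex.one_re]
  -- The deviation `N δ N = N ^ (2/3)` is negligible against `N`, and large against `√N`.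
  set δ : ℕ → ℝ := fun N => (N : ℝ) ^ (-(1 / 3) : ℝ) with hδdef
  have hδ0 (N : ℕ) : 0 ≤ δ N := Real.rpow_nonneg (Nat.cast_nonneg N) _
  have hδ : Tendsto δ atTop (𝓝 0) :=
    (tendsto_rpow_neg_atTop (by norm_num)).comp tendsto_natCast_atTop_atTop
  have hδpos {N : ℕ} (hN : 0 < N) : 0 < N * δ N ∧ N / (N * δ N) ^ 2 = δ N := by
    have hN' : (0 : ℝ) < N := by exact_mod_cast hN
    have hd : 0 < δ N := Real.rpow_pos_of_pos hN' _
    have h3 : δ N ^ 3 = (N : ℝ)⁻¹ := by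
      rw [hδdef, ← Real.rpow_natCast, ← Real.rpow_mul hN'.le, ← Real.rpow_neg_one]
      norm_num
    refine ⟨by positivity, ?_⟩
    rw [div_eq_iff (by positivity)]
    have : δ N * (N * δ N) ^ 2 = N ^ 2 * δ N ^ 3 := by ring
    rw [this, h3]
    field_simp
  choose M ε hε hM hD using fun k => exists_distillation_of_le_card (hω k) (hR k)
    (tendsto_floor_sub_div (hp0 k) hδ0 hδ)
  have hD' := eventually_all.mpr hD
  refine (isAchievableRate_iff hρ.1 _).mpr ⟨fun N => ∏ k, M k N,
    fun N => 1 - (1 - Fintype.card κ * δ N) * ∏ k, (1 - ε k N), ?_, ?_, ?_⟩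
  · have h1 := (hδ.const_mul (Fintype.card κ : ℝ)).const_sub 1
    have h2 := tendsto_finsetProd Finset.univ fun k _ => (hε k).const_sub 1
    simpa using (h1.mul h2).const_sub 1
  · have h1 := tendsto_finsetSum Finset.univ fun k _ => hM k
    have h2 : ((∑ k, (ω k).trace.re.toNNReal * R k : ℝ≥0) : ℝ) = ∑ k, (ω k).trace.re * R k := by
      push_cast
      exact Finset.sum_congr rfl fun k _ => by rw [Real.coe_toNNReal _ (hp0 k)]
    rw [h2]
    refine h1.congr' ?_
    filter_upwards [hD'] with N hN
    rw [← Finset.mul_sum, Nat.cast_prod, Real.logb_prod]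
    exact fun k _ => by exact_mod_cast (hN k).2.1
  · filter_upwards [hD', eventually_gt_atTop 0] with N hN hN0
    have hs (s : Fin N → κ) : ∃ z : ℂ, Attains (localTensor fun t => ω (s t)) (∏ k, M k N) z ∧
        (if ∀ k, ⌊N * (ω k).trace.re - N * δ N⌋₊ ≤ Fintype.card {t // s t = k} then
          ∏ t, (ω (s t)).trace.re else 0) * ∏ k, (1 - ε k N) ≤ z.re := by
      split_ifs with htyp
      · exact attains_localTensor_of_typical hω hp0 (fun k => (hN k).1)
          (fun k τ _ _ hτ => (hN k).2.2 τ hτ) htyp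
      -- On the remaining strings any protocol will do, since its overlap is nonnegative.
      · have := attains_trace_div (M := ∏ k, M k N) (localTensor fun t => ω (s t))
          (Finset.prod_ne_zero_iff.mpr fun k _ => (hN k).2.1)
        refine ⟨_, this, ?_⟩
        rw [zero_mul]
        exact (Complex.le_def.mp (this.nonneg (posSemidef_localTensor fun t => hω (s t)))).1
    choose z hz hzle using hs
    refine ⟨_, (h.pow (τ := Fin N)).attains hz, ?_⟩
    rw [Complex.re_sum, sub_sub_cancel]
    refine le_trans ?_ (Finset.sum_le_sum fun s _ => hzle s)
    rw [← Finset.sum_mul, ← Finset.sum_filter]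
    refine mul_le_mul_of_nonneg_right ?_
      (Finset.prod_nonneg fun k _ => sub_nonneg.mpr (hN k).1)
    have := le_sum_prod_typical hp0 hp1 N (hδpos hN0).1
    rwa [(hδpos hN0).2] at this

/-- The distillable entanglement, finite or not, is a limit of achievable rates. -/
theorem exists_seq_achievableRate {ρ : Matrix (a × b) (a × b) ℂ} (hρ : IsState ρ) :
    ∃ R : ℕ → ℝ≥0, (∀ n, IsAchievableRate ρ (R n)) ∧
      Tendsto (fun n => (R n : ℝ≥0∞)) atTop (𝓝 (distillable ρ)) := by
  have hne : ((fun R : ℝ≥0 => (R : ℝ≥0∞)) '' {R | IsAchievableRate ρ R}).Nonempty :=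
    ⟨_, 0, isAchievableRate_zero hρ, rfl⟩
  obtain ⟨u, -, hu, hmem⟩ := exists_seq_tendsto_sSup hne (OrderTop.bddAbove _)
  choose R hR hRu using hmem
  refine ⟨R, hR, ?_⟩
  rw [sSup_image] at hu
  simp only [hRu]
  exact hu

/-- Distillable entanglement does not increase on average under a local measurement. -/
theorem IsLocalInstrument.sum_distillable_le {ρ : Matrix (a × b) (a × b) ℂ}
    {ω : κ → Matrix (a' × b') (a' × b') ℂ} (h : IsLocalInstrument ρ ω) (hρ : IsState ρ) :
    ∑ k, ENNReal.ofReal (ω k).trace.re * distillable ((ω k).trace⁻¹ • ω k) ≤ distillable ρ := by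
  have hω (k : κ) : (ω k).PosSemidef := h.posSemidef hρ.1 k
  have hseq (k : κ) : ∃ R : ℕ → ℝ≥0,
      (∀ n, (ω k).trace ≠ 0 → IsAchievableRate ((ω k).trace⁻¹ • ω k) (R n)) ∧
      Tendsto (fun n => ENNReal.ofReal (ω k).trace.re * R n) atTop
        (𝓝 (ENNReal.ofReal (ω k).trace.re * distillable ((ω k).trace⁻¹ • ω k))) := by
    rcases eq_or_ne (ω k).trace 0 with h0 | h0
    · exact ⟨fun _ => 0, fun _ h => absurd h0 h, by simp [h0]⟩
    · have hstate : IsState ((ω k).trace⁻¹ • ω k) := by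
        refine ⟨(hω k).smul ?_, by rw [Matrix.trace_smul, smul_eq_mul, inv_mul_cancel₀ h0]⟩
        exact inv_nonneg.mpr (hω k).trace_nonneg
      obtain ⟨R, hR, hlim⟩ := exists_seq_achievableRate hstate
      exact ⟨R, fun n _ => hR n, ENNReal.Tendsto.const_mul hlim (.inr ENNReal.ofReal_ne_top)⟩
  choose R hR hlim using hseq
  refine le_of_tendsto' (tendsto_finsetSum Finset.univ fun k _ => hlim k) fun n => ?_
  have := (h.isAchievableRate hρ (R := fun k => R k n) fun k => hR k n).le_distillable
  push_cast at this
  exact this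

end Measurement

/-! ### Measurements of the helpers -/

section Helpers

variable {m : ℕ} {c : Fin m → Type} [∀ i, Fintype (c i)]
  {a b : Type} [Fintype a] [DecidableEq a] [Fintype b] [DecidableEq b]

theorem kronecker_one_mul_apply {r s u v : Type} [Fintype r] [DecidableEq r] [Fintype s]
    (D : Matrix u s ℂ) (Y : Matrix (s × r) v ℂ) (x : u) (p : r) (y : v) :
    ((D ⊗ₖ (1 : Matrix r r ℂ)) * Y) (x, p) y = ∑ w, D x w * Y (w, p) y := by
  simp [Matrix.mul_apply, Fintype.sum_prod_type, Matrix.one_apply]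

theorem mul_kronecker_one_apply {r s u v : Type} [Fintype r] [DecidableEq r] [Fintype s]
    (Y : Matrix v (s × r) ℂ) (D : Matrix s u ℂ) (y : v) (x : u) (p : r) :
    (Y * (D ⊗ₖ (1 : Matrix r r ℂ))) y (x, p) = ∑ w, Y y (w, p) * D w x := by
  simp [Matrix.mul_apply, Fintype.sum_prod_type, Matrix.one_apply]

/-- Cyclicity of the partial trace for operators on the traced-out systems. -/
theorem traceHelpers_mul_comm (Y : Matrix ((∀ i, c i) × (a × b)) ((∀ i, c i) × (a × b)) ℂ)
    (D : Matrix (∀ i, c i) (∀ i, c i) ℂ) :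
    traceHelpers (Y * (D ⊗ₖ (1 : Matrix (a × b) (a × b) ℂ))) =
      traceHelpers ((D ⊗ₖ (1 : Matrix (a × b) (a × b) ℂ)) * Y) := by
  ext p q
  simp only [traceHelpers, Matrix.of_apply, kronecker_one_mul_apply, mul_kronecker_one_apply]
  rw [Finset.sum_comm]
  simp only [mul_comm]

theorem unnormalizedOutcome_apply
    (ψ : Matrix ((∀ i, c i) × (a × b)) ((∀ i, c i) × (a × b)) ℂ)
    (X : ∀ i, Matrix (c i) (c i) ℂ) (p q : a × b) :
    unnormalizedOutcome ψ X p q = ∑ u, ∑ v, (∏ i, X i (u i) (v i)) * ψ (v, p) (u, q) := by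
  simp only [unnormalizedOutcome, helperTensor, traceHelpers, Matrix.of_apply,
    kronecker_one_mul_apply]

/-- The Kraus operator of a joint outcome on `AB`: each helper in the family applies `B i` and then
finds its system in the basis state `j i`. -/
def helperKraus {ι : Type} [Fintype ι] {h : ι → Type} {r : Type} [DecidableEq r]
    (B : ∀ i, Matrix (h i) (h i) ℂ) (j : ∀ i, h i) : Matrix r (r × ∀ i, h i) ℂ :=
  Matrix.of fun p q => if p = q.1 then ∏ i, B i (j i) (q.2 i) else 0

/-- The Kraus operators of a product of measurements with effects `∑ (B i k)ᴴ * B i k`, over all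
outcomes and all basis states found afterwards, are complete. -/
theorem sum_helperKraus {ι : Type} [Fintype ι] [DecidableEq ι] {h κ : ι → Type}
    [∀ i, Fintype (h i)] [∀ i, DecidableEq (h i)] [∀ i, Fintype (κ i)] {r : Type} [Fintype r]
    [DecidableEq r] (B : ∀ i, κ i → Matrix (h i) (h i) ℂ)
    (hB : ∀ i, ∑ k, (B i k)ᴴ * B i k = 1) :
    ∑ x : ∀ i, κ i × h i, (helperKraus (r := r) (fun i => B i (x i).1) fun i => (x i).2)ᴴ *
      helperKraus (r := r) (fun i => B i (x i).1) (fun i => (x i).2) = 1 := by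
  ext p q
  have entry (i : ι) (u v : h i) :
      ∑ x : κ i × h i, star (B i x.1 x.2 u) * B i x.1 x.2 v = if u = v then 1 else 0 := by
    have := congrFun (congrFun (hB i) u) v
    simpa [Matrix.sum_apply, Matrix.mul_apply, Matrix.conjTranspose_apply, Matrix.one_apply,
      Fintype.sum_prod_type] using this
  have hprod : ∑ x : ∀ i, κ i × h i, ∏ i, (star (B i (x i).1 (x i).2 (p.2 i)) *
      B i (x i).1 (x i).2 (q.2 i)) = if p.2 = q.2 then 1 else 0 := by
    have := Finset.prod_univ_sum (fun i => (Finset.univ : Finset (κ i × h i)))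
      fun i x => star (B i x.1 x.2 (p.2 i)) * B i x.1 x.2 (q.2 i)
    rw [Fintype.piFinset_univ] at this
    rw [← this]
    simp only [entry, Finset.prod_ite_zero, Finset.prod_const_one, funext_iff, Finset.mem_univ,
      true_imp_iff]
  simp only [Matrix.sum_apply, Matrix.mul_apply, Matrix.conjTranspose_apply, helperKraus,
    Matrix.of_apply]
  by_cases h1 : p.1 = q.1
  · rw [Matrix.one_apply, ← show (if p.2 = q.2 then (1 : ℂ) else 0) = if p = q then 1 else 0 by
      simp [Prod.ext_iff, h1], ← hprod]
    refine Finset.sum_congr rfl fun x _ => ?_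
    rw [Finset.sum_eq_single p.1 (fun s _ hs => by simp [hs]) (by simp)]
    simp [h1, Finset.prod_mul_distrib]
  · rw [Matrix.one_apply, if_neg fun h => h1 (congrArg Prod.fst h)]
    refine Finset.sum_eq_zero fun x _ => Finset.sum_eq_zero fun s _ => ?_
    by_cases hs : s = p.1
    · simp [hs, h1]
    · simp [hs]

/-- The regrouping of the systems that defines `cutState`. -/
def cutEquiv (c : Fin m → Type) (a b : Type) (T : Finset (Fin m)) :
    (a × (∀ i : {i // i ∈ T}, c i)) × (b × (∀ i : {i // i ∉ T}, c i)) ≃ (a × b) × (∀ i, c i) :=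
  (Equiv.prodProdProdComm _ _ _ _).trans
    ((Equiv.refl _).prodCongr (Equiv.piEquivPiSubtypeProd (fun i => i ∈ T) c).symm)

theorem isState_cutState {a b : Type} [Fintype a] [Fintype b]
    {ψ : Matrix ((∀ i, c i) × (a × b)) ((∀ i, c i) × (a × b)) ℂ}
    (hψ : IsState ψ) (T : Finset (Fin m)) : IsState (cutState ψ T) := by
  refine ⟨hψ.1.submatrix _, ?_⟩
  rw [← hψ.2]
  exact Fintype.sum_equiv ((cutEquiv c a b T).trans (Equiv.prodComm _ _)) _ _ fun _ => rfl

/-- Summing over the basis states in which the helpers find their systems is the partial trace. -/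
theorem sum_helperKraus_conj
    (ψ : Matrix ((∀ i, c i) × (a × b)) ((∀ i, c i) × (a × b)) ℂ)
    (B : ∀ i, Matrix (c i) (c i) ℂ) :
    ∑ j, helperKraus (r := a × b) B j * ψ.submatrix (Equiv.prodComm _ _) (Equiv.prodComm _ _) *
      (helperKraus (r := a × b) B j)ᴴ = unnormalizedOutcome ψ fun i => (B i)ᴴ * B i := by
  have h1 : helperTensor (fun i => (B i)ᴴ * B i) = (piTensor B)ᴴ * piTensor B := by
    rw [piTensor_conjTranspose, piTensor_mul]
    rfl
  have h2 : (((piTensor B)ᴴ * piTensor B) ⊗ₖ (1 : Matrix (a × b) (a × b) ℂ)) =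
      (piTensor B)ᴴ ⊗ₖ (1 : Matrix (a × b) (a × b) ℂ) *
        (piTensor B ⊗ₖ (1 : Matrix (a × b) (a × b) ℂ)) := by
    rw [← Matrix.mul_kronecker_mul, Matrix.one_mul]
  have h3 (j : ∀ i, c i) : helperKraus (r := a × b) B j =
      (piTensor B ⊗ₖ (1 : Matrix (a × b) (a × b) ℂ)).submatrix (fun p => (j, p))
        (Equiv.prodComm _ _) := by
    ext p q
    simp [helperKraus, piTensor, Matrix.kroneckerMap_apply, Matrix.one_apply]
  rw [unnormalizedOutcome, h1, h2, Matrix.mul_assoc, ← traceHelpers_mul_comm]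
  ext p q
  simp only [Matrix.sum_apply, h3, Matrix.conjTranspose_submatrix, Matrix.submatrix_mul_equiv,
    Matrix.conjTranspose_kronecker, Matrix.conjTranspose_one]
  rfl

/-- Alice and Bob can carry out the measurements of all the helpers, each on their side of the
cut. -/
theorem isLocalInstrument_cutState [∀ i, DecidableEq (c i)]
    (ψ : Matrix ((∀ i, c i) × (a × b)) ((∀ i, c i) × (a × b)) ℂ)
    (T : Finset (Fin m)) {κ : Fin m → Type} [∀ i, Fintype (κ i)] [∀ i, DecidableEq (κ i)]
    (E : ∀ i, POVM (κ i) (c i)) :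
    IsLocalInstrument (cutState ψ T)
      fun k : ∀ i, κ i => unnormalizedOutcome ψ fun i => (E i).effect (k i) := by
  choose B hB using fun i k => exists_eq_conjTranspose_mul_self ((E i).posSemidef k)
  have hB1 (i : Fin m) : ∑ k, (B i k)ᴴ * B i k = 1 := by
    rw [← (E i).sum_eq_one]
    exact Finset.sum_congr rfl fun k _ => (hB i k).symm
  let G := Equiv.piEquivPiSubtypeProd (fun i => i ∈ T) fun i => κ i × c i
  refine ⟨∀ i : {i // i ∈ T}, κ i × c i, ∀ i : {i // i ∉ T}, κ i × c i, inferInstance,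
    inferInstance, fun x => helperKraus (fun i => B i (x i).1) fun i => (x i).2,
    fun y => helperKraus (fun i => B i (y i).1) fun i => (y i).2, fun z i => (G.symm z i).1,
    sum_helperKraus (fun i : {i // i ∈ T} => B i) fun i => hB1 i,
    sum_helperKraus (fun i : {i // i ∉ T} => B i) fun i => hB1 i, fun k => ?_⟩
  have hK (w : ∀ i, κ i × c i) :
      (helperKraus (r := a) (fun i : {i // i ∈ T} => B i ((G w).1 i).1) fun i => ((G w).1 i).2) ⊗ₖ
        (helperKraus (r := b) (fun i : {i // i ∉ T} => B i ((G w).2 i).1) fun i => ((G w).2 i).2) =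
      (helperKraus (r := a × b) (fun i => B i (w i).1) fun i => (w i).2).submatrix id
        (cutEquiv c a b T) := by
    ext p q
    have hprod : (∏ i : {i // i ∈ T}, B i (w i).1 (w i).2 (q.1.2 i)) *
        ∏ i : {i // i ∉ T}, B i (w i).1 (w i).2 (q.2.2 i) =
        ∏ i, B i (w i).1 (w i).2 (if h : i ∈ T then q.1.2 ⟨i, h⟩ else q.2.2 ⟨i, h⟩) := by
      have h1 (i : {i // i ∈ T}) : q.1.2 i =
          if h : (i : Fin m) ∈ T then q.1.2 ⟨i, h⟩ else q.2.2 ⟨i, h⟩ := by rw [dif_pos i.2]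
      have h2 (i : {i // i ∉ T}) : q.2.2 i =
          if h : (i : Fin m) ∈ T then q.1.2 ⟨i, h⟩ else q.2.2 ⟨i, h⟩ := by rw [dif_neg i.2]
      convert Fintype.prod_subtype_mul_prod_subtype (fun i => i ∈ T) fun i =>
        B i (w i).1 (w i).2 (if h : i ∈ T then q.1.2 ⟨i, h⟩ else q.2.2 ⟨i, h⟩)
      · exact h1 _
      · exact h2 _
    have hq : cutEquiv c a b T q = ((q.1.1, q.2.1),
      fun i => if h : i ∈ T then q.1.2 ⟨i, h⟩ else q.2.2 ⟨i, h⟩) := rfl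
    simp only [Matrix.kroneckerMap_apply, helperKraus, Matrix.of_apply, Matrix.submatrix_apply, hq,
      id, ← hprod, Prod.ext_iff]
    by_cases h1 : p.1 = q.1.1 <;> by_cases h2 : p.2 = q.2.1 <;> simp [h1, h2, G]
  have hterm (w : ∀ i, κ i × c i) :
      ((helperKraus (r := a) (fun i : {i // i ∈ T} => B i ((G w).1 i).1) fun i => ((G w).1 i).2) ⊗ₖ
        (helperKraus (r := b) (fun i : {i // i ∉ T} => B i ((G w).2 i).1) fun i => ((G w).2 i).2)) *
        cutState ψ T *
      ((helperKraus (r := a) (fun i : {i // i ∈ T} => B i ((G w).1 i).1) fun i => ((G w).1 i).2) ⊗ₖ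
        (helperKraus (r := b) (fun i : {i // i ∉ T} => B i ((G w).2 i).1)
          fun i => ((G w).2 i).2))ᴴ =
      helperKraus (r := a × b) (fun i => B i (w i).1) (fun i => (w i).2) *
        ψ.submatrix (Equiv.prodComm _ _) (Equiv.prodComm _ _) *
        (helperKraus (r := a × b) (fun i => B i (w i).1) (fun i => (w i).2))ᴴ := by
    have hc : cutState ψ T = (ψ.submatrix (Equiv.prodComm _ _) (Equiv.prodComm _ _)).submatrix
      (cutEquiv c a b T) (cutEquiv c a b T) := rfl
    rw [hK, hc, Matrix.conjTranspose_submatrix, Matrix.submatrix_mul_equiv,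
      Matrix.submatrix_mul_equiv, Matrix.submatrix_id_id]
  have hE : (fun i => (E i).effect (k i)) = fun i => (B i (k i))ᴴ * B i (k i) :=
    funext fun i => hB i (k i)
  change unnormalizedOutcome ψ (fun i => (E i).effect (k i)) = _
  rw [hE, ← sum_helperKraus_conj]
  let F := (Equiv.arrowProdEquivProdArrow (Fin m) κ c)
  symm
  refine Finset.sum_bij' (fun z _ => (F (G.symm z)).2) (fun j _ => G (F.symm (k, j))) ?_ ?_ ?_ ?_ ?_
  · exact fun _ _ => Finset.mem_univ _
  · intro j _
    simp only [Finset.mem_filter, Finset.mem_univ, true_and, Equiv.symm_apply_apply]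
    rfl
  · intro z hz
    simp only [Finset.mem_filter, Finset.mem_univ, true_and] at hz
    have : (k, (F (G.symm z)).2) = F (G.symm z) := Prod.ext hz.symm rfl
    rw [this, Equiv.symm_apply_apply, Equiv.apply_symm_apply]
  · intro j _
    simp
  · intro z hz
    simp only [Finset.mem_filter, Finset.mem_univ, true_and] at hz
    subst hz
    obtain ⟨w, rfl⟩ := G.surjective z
    rw [Equiv.symm_apply_apply]
    exact hterm w

end Helpers

/-! ### Entanglement of assistance and cuts -/

section Assistance

variable {m : ℕ} {c : Fin m → Type} [∀ i, Fintype (c i)] [∀ i, DecidableEq (c i)]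
  {a b : Type} [Fintype a] [DecidableEq a] [Fintype b] [DecidableEq b]

theorem posSemidef_unnormalizedOutcome
    {ψ : Matrix ((∀ i, c i) × (a × b)) ((∀ i, c i) × (a × b)) ℂ} (hψ : ψ.PosSemidef)
    {X : ∀ i, Matrix (c i) (c i) ℂ} (hX : ∀ i, (X i).PosSemidef) :
    (unnormalizedOutcome ψ X).PosSemidef := by
  choose B hB using fun i => exists_eq_conjTranspose_mul_self (hX i)
  rw [show X = fun i => (B i)ᴴ * B i from funext hB, ← sum_helperKraus_conj]
  exact Matrix.posSemidef_sum _ fun j _ => (hψ.submatrix _).mul_mul_conjTranspose_same _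

theorem trace_unnormalizedOutcome
    {ψ : Matrix ((∀ i, c i) × (a × b)) ((∀ i, c i) × (a × b)) ℂ} (hψ : ψ.PosSemidef)
    {X : ∀ i, Matrix (c i) (c i) ℂ} (hX : ∀ i, (X i).PosSemidef) :
    (unnormalizedOutcome ψ X).trace = (outcomeProb ψ X : ℂ) ∧ 0 ≤ outcomeProb ψ X := by
  obtain ⟨hre, him⟩ :=
    Complex.le_def.mp (posSemidef_unnormalizedOutcome hψ hX).trace_nonneg
  exact ⟨Complex.ext rfl (by simpa using him.symm), hre⟩

theorem outcomeState_eq {ψ : Matrix ((∀ i, c i) × (a × b)) ((∀ i, c i) × (a × b)) ℂ}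
    (hψ : ψ.PosSemidef) {X : ∀ i, Matrix (c i) (c i) ℂ} (hX : ∀ i, (X i).PosSemidef) :
    outcomeState ψ X = (unnormalizedOutcome ψ X).trace⁻¹ • unnormalizedOutcome ψ X := by
  rw [outcomeState, (trace_unnormalizedOutcome hψ hX).1, Complex.ofReal_inv]

theorem isState_outcomeState {ψ : Matrix ((∀ i, c i) × (a × b)) ((∀ i, c i) × (a × b)) ℂ}
    (hψ : ψ.PosSemidef) {X : ∀ i, Matrix (c i) (c i) ℂ} (hX : ∀ i, (X i).PosSemidef)
    (h0 : outcomeProb ψ X ≠ 0) : IsState (outcomeState ψ X) := by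
  have hω := posSemidef_unnormalizedOutcome hψ hX
  rw [outcomeState_eq hψ hX]
  refine ⟨hω.smul (inv_nonneg.mpr hω.trace_nonneg), ?_⟩
  rw [Matrix.trace_smul, smul_eq_mul, inv_mul_cancel₀]
  rw [(trace_unnormalizedOutcome hψ hX).1]
  exact_mod_cast h0

/-- Helpers who stand on one side of a cut can be simulated by the party on that side. -/
theorem assistance_le_distillable_cutState
    {ψ : Matrix ((∀ i, c i) × (a × b)) ((∀ i, c i) × (a × b)) ℂ} (hψ : IsState ψ)
    (T : Finset (Fin m)) : assistance ψ ≤ distillable (cutState ψ T) := by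
  refine iSup₂_le fun κ E => ?_
  refine le_trans (le_of_eq ?_)
    ((isLocalInstrument_cutState ψ T E).sum_distillable_le (isState_cutState hψ T))
  refine Finset.sum_congr rfl fun k _ => ?_
  rw [outcomeState_eq hψ.1 fun i => (E i).posSemidef (k i)]
  rfl

theorem sum_outcomeProb {ψ : Matrix ((∀ i, c i) × (a × b)) ((∀ i, c i) × (a × b)) ℂ}
    (hψ : IsState ψ) {κ : Fin m → Type} [∀ i, Fintype (κ i)] [∀ i, DecidableEq (κ i)]
    (E : ∀ i, POVM (κ i) (c i)) :
    ∑ k : ∀ i, κ i, outcomeProb ψ (fun i => (E i).effect (k i)) = 1 := by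
  -- Any cut will do: total probability is the trace of the state across the cut.
  have := (isLocalInstrument_cutState ψ ∅ E).sum_trace
  rw [(isState_cutState hψ ∅).2] at this
  simp only [outcomeProb, ← Complex.re_sum, this, Complex.one_re]

/-- Relabelling of the outcomes of a measurement. -/
def POVM.relabel {κ κ' r : Type} [Fintype κ] [Fintype κ'] [Fintype r] [DecidableEq r]
    (E : POVM κ r) (e : κ' ≃ κ) : POVM κ' r where
  effect x := E.effect (e x)
  posSemidef x := E.posSemidef (e x)
  sum_eq_one := by rw [e.sum_comp, E.sum_eq_one]

/-- The outcomes of the helpers' measurements may be labelled by any finite types. -/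
theorem le_assistance (ψ : Matrix ((∀ i, c i) × (a × b)) ((∀ i, c i) × (a × b)) ℂ)
    {κ : Fin m → Type} [∀ i, Fintype (κ i)] (E : ∀ i, POVM (κ i) (c i)) :
    ∑ k : ∀ i, κ i, ENNReal.ofReal (outcomeProb ψ fun i => (E i).effect (k i)) *
      distillable (outcomeState ψ fun i => (E i).effect (k i)) ≤ assistance ψ := by
  refine le_iSup₂_of_le (fun i => Fintype.card (κ i))
    (fun i => (E i).relabel (Fintype.equivFin (κ i)).symm) (le_of_eq ?_)
  exact ((Equiv.piCongrRight fun i => (Fintype.equivFin (κ i)).symm).sum_comp fun k =>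
    ENNReal.ofReal (outcomeProb ψ fun i => (E i).effect (k i)) *
      distillable (outcomeState ψ fun i => (E i).effect (k i))).symm

end Assistance

/-! ### Superadditivity of the entanglement of assistance -/

section Superadditivity

/-- The product of two measurements, on a system `r` that is identified with `r₁ × r₂`. -/
def POVM.prod {κ₁ κ₂ r r₁ r₂ : Type} [Fintype κ₁] [Fintype κ₂] [Fintype r] [DecidableEq r]
    [Fintype r₁] [DecidableEq r₁] [Fintype r₂] [DecidableEq r₂] (E₁ : POVM κ₁ r₁)
    (E₂ : POVM κ₂ r₂) (e : r ≃ r₁ × r₂) : POVM (κ₁ × κ₂) r where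
  effect x := (E₁.effect x.1 ⊗ₖ E₂.effect x.2).submatrix e e
  posSemidef x := ((E₁.posSemidef x.1).kronecker (E₂.posSemidef x.2)).submatrix e
  sum_eq_one := by
    ext p q
    have h1 := congrFun (congrFun E₁.sum_eq_one (e p).1) (e q).1
    have h2 := congrFun (congrFun E₂.sum_eq_one (e p).2) (e q).2
    rw [Matrix.sum_apply] at h1 h2 ⊢
    simp only [Matrix.submatrix_apply, Matrix.kroneckerMap_apply, Fintype.sum_prod_type]
    rw [← Finset.sum_mul_sum, h1, h2]
    simp only [Matrix.one_apply, ← e.injective.eq_iff (a := p), Prod.ext_iff]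
    by_cases h : (e p).1 = (e q).1 <;> simp [h]

variable {m : ℕ} {c c₁ c₂ : Fin m → Type} [∀ i, Fintype (c i)] [∀ i, Fintype (c₁ i)]
  [∀ i, Fintype (c₂ i)]
  {a b a₁ b₁ a₂ b₂ : Type} [Fintype a] [DecidableEq a] [Fintype b] [DecidableEq b]
  [Fintype a₁] [DecidableEq a₁] [Fintype b₁] [DecidableEq b₁]
  [Fintype a₂] [DecidableEq a₂] [Fintype b₂] [DecidableEq b₂]
  {ψ : Matrix ((∀ i, c i) × (a × b)) ((∀ i, c i) × (a × b)) ℂ}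
  {ψ₁ : Matrix ((∀ i, c₁ i) × (a₁ × b₁)) ((∀ i, c₁ i) × (a₁ × b₁)) ℂ}
  {ψ₂ : Matrix ((∀ i, c₂ i) × (a₂ × b₂)) ((∀ i, c₂ i) × (a₂ × b₂)) ℂ}
  (e : ∀ i, c i ≃ c₁ i × c₂ i) (f : a ≃ a₁ × a₂) (g : b ≃ b₁ × b₂)

/-- A product measurement on a product state `ψ = ψ₁ ⊗ ψ₂` leaves a product state. The bijections
`e i`, `f`, `g` split the systems of the helpers, of Alice and of Bob. -/
theorem unnormalizedOutcome_tensor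
    (hψ : ∀ p q, ψ p q =
      ψ₁ (fun i => (e i (p.1 i)).1, (f p.2.1).1, (g p.2.2).1)
        (fun i => (e i (q.1 i)).1, (f q.2.1).1, (g q.2.2).1) *
      ψ₂ (fun i => (e i (p.1 i)).2, (f p.2.1).2, (g p.2.2).2)
        (fun i => (e i (q.1 i)).2, (f q.2.1).2, (g q.2.2).2))
    (X₁ : ∀ i, Matrix (c₁ i) (c₁ i) ℂ) (X₂ : ∀ i, Matrix (c₂ i) (c₂ i) ℂ) :
    unnormalizedOutcome ψ (fun i => (X₁ i ⊗ₖ X₂ i).submatrix (e i) (e i)) =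
      (bipartiteTensor (unnormalizedOutcome ψ₁ X₁) (unnormalizedOutcome ψ₂ X₂)).submatrix
        (Prod.map f g) (Prod.map f g) := by
  let F : (∀ i, c i) ≃ (∀ i, c₁ i) × (∀ i, c₂ i) :=
    (Equiv.piCongrRight e).trans (Equiv.arrowProdEquivProdArrow _ _ _)
  have sum_F (h : (∀ i, c i) → ℂ) : ∑ u, h u = ∑ u₁, ∑ u₂, h (F.symm (u₁, u₂)) := by
    rw [← F.symm.sum_comp, Fintype.sum_prod_type]
  have hF (u₁ : ∀ i, c₁ i) (u₂ : ∀ i, c₂ i) (i : Fin m) :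
      e i (F.symm (u₁, u₂) i) = (u₁ i, u₂ i) := by
    change e i ((e i).symm _) = _
    rw [Equiv.apply_symm_apply]
    rfl
  ext p q
  simp only [unnormalizedOutcome_apply, sum_F, hψ, hF, Matrix.submatrix_apply,
    Matrix.kroneckerMap_apply, Finset.prod_mul_distrib, bipartiteTensor, Matrix.of_apply,
    Prod.map_fst, Prod.map_snd, Finset.sum_mul_sum]
  refine Finset.sum_congr rfl fun u₁ _ => Finset.sum_congr rfl fun u₂ _ =>
    Finset.sum_congr rfl fun v₁ _ => Finset.sum_congr rfl fun v₂ _ => ?_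
  ring

/-- The helpers may measure the two factors of a product state independently. -/
theorem assistance_add_le_tensor [∀ i, DecidableEq (c i)] [∀ i, DecidableEq (c₁ i)]
    [∀ i, DecidableEq (c₂ i)] (hψ₁ : IsState ψ₁) (hψ₂ : IsState ψ₂)
    (hψ : ∀ p q, ψ p q =
      ψ₁ (fun i => (e i (p.1 i)).1, (f p.2.1).1, (g p.2.2).1)
        (fun i => (e i (q.1 i)).1, (f q.2.1).1, (g q.2.2).1) *
      ψ₂ (fun i => (e i (p.1 i)).2, (f p.2.1).2, (g p.2.2).2)
        (fun i => (e i (q.1 i)).2, (f q.2.1).2, (g q.2.2).2)) :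
    assistance ψ₁ + assistance ψ₂ ≤ assistance ψ := by
  have trivial_povm (r : Type) [Fintype r] [DecidableEq r] : Nonempty (POVM (Fin 1) r) :=
    ⟨⟨fun _ => 1, fun _ => Matrix.PosSemidef.one, by simp⟩⟩
  have hne (r : Fin m → Type) [∀ i, Fintype (r i)] [∀ i, DecidableEq (r i)] :
      Nonempty (Σ κ : Fin m → ℕ, ∀ i, POVM (Fin (κ i)) (r i)) :=
    ⟨⟨fun _ => 1, fun i => (trivial_povm (r i)).some⟩⟩
  have := hne c₁
  have := hne c₂
  conv_lhs => rw [assistance, assistance, iSup_sigma', iSup_sigma']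
  refine ENNReal.iSup_add_iSup_le ?_
  rintro ⟨κ₁, E₁⟩ ⟨κ₂, E₂⟩
  have hprod : ∑ k₁ : ∀ i, Fin (κ₁ i), ∑ k₂ : ∀ i, Fin (κ₂ i),
      ENNReal.ofReal (outcomeProb ψ fun i =>
        ((E₁ i).prod (E₂ i) (e i)).effect (k₁ i, k₂ i)) *
      distillable (outcomeState ψ fun i => ((E₁ i).prod (E₂ i) (e i)).effect (k₁ i, k₂ i)) ≤
      assistance ψ := by
    refine le_trans (le_of_eq ?_) (le_assistance ψ fun i => (E₁ i).prod (E₂ i) (e i))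
    rw [← (Equiv.arrowProdEquivProdArrow (Fin m) (fun i => Fin (κ₁ i))
      fun i => Fin (κ₂ i)).symm.sum_comp, Fintype.sum_prod_type]
    rfl
  refine le_trans ?_ hprod
  have hterm (k₁ : ∀ i, Fin (κ₁ i)) (k₂ : ∀ i, Fin (κ₂ i)) :
      ENNReal.ofReal (outcomeProb ψ₁ fun i => (E₁ i).effect (k₁ i)) *
        ENNReal.ofReal (outcomeProb ψ₂ fun i => (E₂ i).effect (k₂ i)) *
        (distillable (outcomeState ψ₁ fun i => (E₁ i).effect (k₁ i)) +
          distillable (outcomeState ψ₂ fun i => (E₂ i).effect (k₂ i))) ≤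
      ENNReal.ofReal (outcomeProb ψ fun i =>
        ((E₁ i).prod (E₂ i) (e i)).effect (k₁ i, k₂ i)) *
      distillable (outcomeState ψ fun i =>
        ((E₁ i).prod (E₂ i) (e i)).effect (k₁ i, k₂ i)) := by
    set X₁ := fun i => (E₁ i).effect (k₁ i)
    set X₂ := fun i => (E₂ i).effect (k₂ i)
    have hX₁ (i : Fin m) : (X₁ i).PosSemidef := (E₁ i).posSemidef (k₁ i)
    have hX₂ (i : Fin m) : (X₂ i).PosSemidef := (E₂ i).posSemidef (k₂ i)
    change _ ≤ ENNReal.ofReal (outcomeProb ψ fun i => (X₁ i ⊗ₖ X₂ i).submatrix (e i) (e i)) *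
      distillable (outcomeState ψ fun i => (X₁ i ⊗ₖ X₂ i).submatrix (e i) (e i))
    have hun := unnormalizedOutcome_tensor e f g hψ X₁ X₂
    obtain ⟨ht₁, hp₁⟩ := trace_unnormalizedOutcome hψ₁.1 hX₁
    obtain ⟨ht₂, hp₂⟩ := trace_unnormalizedOutcome hψ₂.1 hX₂
    have hprob : outcomeProb ψ (fun i => (X₁ i ⊗ₖ X₂ i).submatrix (e i) (e i)) =
        outcomeProb ψ₁ X₁ * outcomeProb ψ₂ X₂ := by
      have htr : (unnormalizedOutcome ψ fun i => (X₁ i ⊗ₖ X₂ i).submatrix (e i) (e i)).trace =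
          (unnormalizedOutcome ψ₁ X₁).trace * (unnormalizedOutcome ψ₂ X₂).trace := by
        rw [← trace_bipartiteTensor, hun]
        exact Fintype.sum_equiv (f.prodCongr g) _ _ fun _ => rfl
      rw [outcomeProb, htr, ht₁, ht₂, ← Complex.ofReal_mul, Complex.ofReal_re]
    have hstate : outcomeState ψ (fun i => (X₁ i ⊗ₖ X₂ i).submatrix (e i) (e i)) =
        (bipartiteTensor (outcomeState ψ₁ X₁) (outcomeState ψ₂ X₂)).submatrix
          (Prod.map f g) (Prod.map f g) := by
      rw [outcomeState, hprob, hun]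
      ext p q
      simp only [outcomeState, bipartiteTensor, Matrix.smul_apply, Matrix.submatrix_apply,
        Matrix.of_apply, smul_eq_mul, mul_inv, Complex.ofReal_mul]
      ring
    rw [hprob, ENNReal.ofReal_mul hp₁]
    -- Outcomes of probability zero have no state, but contribute nothing.
    rcases eq_or_ne (outcomeProb ψ₁ X₁) 0 with h₁ | h₁
    · simp [h₁]
    rcases eq_or_ne (outcomeProb ψ₂ X₂) 0 with h₂ | h₂
    · simp [h₂]
    have hs₁ := isState_outcomeState hψ₁.1 hX₁ h₁
    have hs₂ := isState_outcomeState hψ₂.1 hX₂ h₂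
    rw [hstate]
    exact mul_le_mul_right ((distillable_add_le_tensor hs₁ hs₂).trans
      (distillable_le_submatrix (posSemidef_bipartiteTensor hs₁.1 hs₂.1) f g)) _
  refine le_trans (le_of_eq ?_)
    (Finset.sum_le_sum fun k₁ _ => Finset.sum_le_sum fun k₂ _ => hterm k₁ k₂)
  have hone₁ : ∑ k : ∀ i, Fin (κ₁ i),
      ENNReal.ofReal (outcomeProb ψ₁ fun i => (E₁ i).effect (k i)) = 1 := by
    rw [← ENNReal.ofReal_sum_of_nonneg fun k _ =>
      (trace_unnormalizedOutcome hψ₁.1 fun i => (E₁ i).posSemidef (k i)).2, sum_outcomeProb hψ₁,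
      ENNReal.ofReal_one]
  have hone₂ : ∑ k : ∀ i, Fin (κ₂ i),
      ENNReal.ofReal (outcomeProb ψ₂ fun i => (E₂ i).effect (k i)) = 1 := by
    rw [← ENNReal.ofReal_sum_of_nonneg fun k _ =>
      (trace_unnormalizedOutcome hψ₂.1 fun i => (E₂ i).posSemidef (k i)).2, sum_outcomeProb hψ₂,
      ENNReal.ofReal_one]
  have marginals {K₁ K₂ : Type} [Fintype K₁] [Fintype K₂] (p D : K₁ → ℝ≥0∞) (q D' : K₂ → ℝ≥0∞)
      (hp : ∑ k, p k = 1) (hq : ∑ k, q k = 1) :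
      ∑ k, p k * D k + ∑ k, q k * D' k = ∑ k, ∑ l, p k * q l * (D k + D' l) := by
    have e1 : ∑ k, ∑ l, p k * q l * D k = ∑ k, p k * D k := by
      refine Finset.sum_congr rfl fun k _ => ?_
      rw [← Finset.sum_mul, ← Finset.mul_sum, hq, mul_one]
    have e2 : ∑ k, ∑ l, p k * q l * D' l = ∑ l, q l * D' l := by
      rw [Finset.sum_comm]
      refine Finset.sum_congr rfl fun l _ => ?_
      rw [← Finset.sum_mul, ← Finset.sum_mul, hp, one_mul]
    simp only [mul_add, Finset.sum_add_distrib, e1, e2]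
  exact marginals _ _ _ _ hone₁ hone₂

end Superadditivity

/-! ### Many copies -/

section Copies

variable {m : ℕ} {c : Fin m → Type} [∀ i, Fintype (c i)] [∀ i, DecidableEq (c i)]
  {a b : Type} [Fintype a] [DecidableEq a] [Fintype b] [DecidableEq b]

theorem isState_multipartitePower
    {ψ : Matrix ((∀ i, c i) × (a × b)) ((∀ i, c i) × (a × b)) ℂ} (hψ : IsState ψ) (n : ℕ) :
    IsState (multipartitePower ψ n) := by
  let F : (∀ i, Fin n → c i) × ((Fin n → a) × (Fin n → b)) ≃ (Fin n → (∀ i, c i) × (a × b)) :=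
    { toFun := fun p t => (fun i => p.1 i t, p.2.1 t, p.2.2 t)
      invFun := fun u => (fun i t => (u t).1 i, fun t => (u t).2.1, fun t => (u t).2.2)
      left_inv := fun _ => rfl
      right_inv := fun _ => rfl }
  have hF : multipartitePower ψ n = (piTensor fun _ : Fin n => ψ).submatrix F F := rfl
  refine ⟨hF ▸ (posSemidef_piTensor fun _ => hψ.1).submatrix _, ?_⟩
  have htr : (piTensor fun _ : Fin n => ψ).trace = 1 := by simp [trace_piTensor, hψ.2]
  rw [← htr]
  exact Fintype.sum_equiv F _ _ fun _ => rfl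

theorem assistance_multipartitePower_add_le
    {ψ : Matrix ((∀ i, c i) × (a × b)) ((∀ i, c i) × (a × b)) ℂ} (hψ : IsState ψ) (n k : ℕ) :
    assistance (multipartitePower ψ n) + assistance (multipartitePower ψ k) ≤
      assistance (multipartitePower ψ (n + k)) := by
  refine assistance_add_le_tensor (fun i => (Fin.appendEquiv n k).symm)
    (Fin.appendEquiv n k).symm (Fin.appendEquiv n k).symm (isState_multipartitePower hψ n)
    (isState_multipartitePower hψ k) fun p q => ?_
  simp only [multipartitePower, Matrix.of_apply, Fin.prod_univ_add]
  rfl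

/-- Taking copies and cutting commute, up to a local relabelling. -/
theorem distillable_cutState_multipartitePower_le
    {ψ : Matrix ((∀ i, c i) × (a × b)) ((∀ i, c i) × (a × b)) ℂ} (hψ : IsState ψ)
    (T : Finset (Fin m)) (n : ℕ) :
    distillable (cutState (multipartitePower ψ n) T) ≤
      distillable (bipartitePower (cutState ψ T) n) := by
  have regroup {ι : Type} (r : Type) (h : ι → Type) :
      ∃ F : (Fin n → r × ∀ i, h i) ≃ (Fin n → r) × (∀ i, Fin n → h i),
        ∀ u, F u = (fun t => (u t).1, fun i t => (u t).2 i) :=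
    ⟨⟨fun u => (fun t => (u t).1, fun i t => (u t).2 i), fun v t => (v.1 t, fun i => v.2 i t),
      fun _ => rfl, fun _ => rfl⟩, fun _ => rfl⟩
  obtain ⟨F, hF⟩ := regroup a fun i : {i // i ∈ T} => c i
  obtain ⟨G, hG⟩ := regroup b fun i : {i // i ∉ T} => c i
  refine (distillable_le_submatrix
    (isState_cutState (isState_multipartitePower hψ n) T).1 F G).trans_eq (congrArg _ ?_)
  have key (p : (Fin n → a × ∀ i : {i // i ∈ T}, c i) × (Fin n → b × ∀ i : {i // i ∉ T}, c i))
      (t : Fin n) (i : Fin m) :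
      (if h : i ∈ T then (F p.1).2 ⟨i, h⟩ else (G p.2).2 ⟨i, h⟩ : Fin n → c i) t =
        if h : i ∈ T then (p.1 t).2 ⟨i, h⟩ else (p.2 t).2 ⟨i, h⟩ := by
    rw [hF, hG]
    split_ifs <;> rfl
  ext p q
  simp only [cutState, multipartitePower, bipartitePower, Matrix.submatrix_apply, Matrix.of_apply,
    Prod.map_fst, Prod.map_snd, key]
  simp only [hF, hG]

/-- Fekete's lemma for superadditive sequences in `[0, ∞]`. -/
theorem tendsto_div_of_superadditive {u : ℕ → ℝ≥0∞} (hu : ∀ n k, u n + u k ≤ u (n + k)) :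
    Tendsto (fun n => u n / n) atTop (𝓝 (⨆ (n : ℕ) (_ : n ≠ 0), u n / n)) := by
  have hmul (k q r : ℕ) : q * u k ≤ u (q * k + r) := by
    induction q with
    | zero => simp
    | succ q ih =>
      calc ((q + 1 : ℕ) : ℝ≥0∞) * u k = q * u k + u k := by push_cast; ring
        _ ≤ u (q * k + r) + u k := by gcongr
        _ ≤ u (q * k + r + k) := hu _ _
        _ = u ((q + 1) * k + r) := by congr 1; ring
  refine tendsto_order.mpr ⟨fun x hx => ?_, fun x hx => ?_⟩
  · obtain ⟨k, hk⟩ := lt_iSup_iff.mp hx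
    obtain ⟨hk0, hk⟩ := lt_iSup_iff.mp hk
    have hreal : Tendsto (fun n : ℕ => ((n / k : ℕ) : ℝ) / n) atTop (𝓝 ((k : ℝ)⁻¹)) := by
      refine ((tendsto_nat_floor_mul_div_atTop (R := ℝ) (a := (k : ℝ)⁻¹) (by positivity)).comp
        tendsto_natCast_atTop_atTop).congr fun n => ?_
      simp only [Function.comp_apply]
      rw [inv_mul_eq_div, Nat.floor_div_eq_div]
    have hk' : (0 : ℝ) < k := by exact_mod_cast Nat.pos_of_ne_zero hk0
    have hennreal : Tendsto (fun n : ℕ => ((n / k : ℕ) : ℝ≥0∞) / n) atTop (𝓝 ((k : ℝ≥0∞)⁻¹)) := by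
      have := ENNReal.tendsto_ofReal hreal
      rw [ENNReal.ofReal_inv_of_pos hk', ENNReal.ofReal_natCast] at this
      refine this.congr' ?_
      filter_upwards [eventually_gt_atTop 0] with n hn
      rw [ENNReal.ofReal_div_of_pos (by exact_mod_cast hn), ENNReal.ofReal_natCast,
        ENNReal.ofReal_natCast]
    have hlim : Tendsto (fun n : ℕ => ((n / k : ℕ) : ℝ≥0∞) / n * u k) atTop (𝓝 (u k / k)) := by
      rw [div_eq_mul_inv, mul_comm (u k)]
      exact ENNReal.Tendsto.mul_const hennreal
        (.inl (ENNReal.inv_ne_zero.mpr (ENNReal.natCast_ne_top k)))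
    filter_upwards [hlim.eventually_const_lt hk] with n hn
    refine hn.trans_le ?_
    rw [ENNReal.mul_div_right_comm.symm]
    refine ENNReal.div_le_div_right ?_ _
    have := hmul k (n / k) (n % k)
    rwa [mul_comm (n / k) k, Nat.div_add_mod] at this
  · filter_upwards [eventually_ne_atTop 0] with n hn
    exact (le_iSup₂_of_le n hn le_rfl).trans_lt hx

end Copies

end AssistedDistillation

end

theorem proposition4 {m : ℕ} {c : Fin m → Type} [∀ i, Fintype (c i)] [∀ i, DecidableEq (c i)]
    {a b : Type} [Fintype a] [DecidableEq a] [Fintype b] [DecidableEq b]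
    (ψ : Matrix ((∀ i, c i) × (a × b)) ((∀ i, c i) × (a × b)) ℂ)
    (hψ : AssistedDistillation.IsState ψ) :
    Tendsto (AssistedDistillation.assistanceRate ψ) atTop
        (𝓝 (AssistedDistillation.asymptoticAssistance ψ)) ∧
      AssistedDistillation.asymptoticAssistance ψ ≤
        ⨅ T : Finset (Fin m),
          AssistedDistillation.distillable (AssistedDistillation.cutState ψ T) := by
  have hlim : Tendsto (AssistedDistillation.assistanceRate ψ) atTop _ :=
    AssistedDistillation.tendsto_div_of_superadditive
      (AssistedDistillation.assistance_multipartitePower_add_le hψ)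
  have heq : AssistedDistillation.asymptoticAssistance ψ = _ := hlim.limUnder_eq
  refine ⟨heq ▸ hlim, le_iInf fun T => ?_⟩
  rw [heq]
  refine iSup₂_le fun n hn => ENNReal.div_le_of_le_mul' ?_
  exact (AssistedDistillation.assistance_le_distillable_cutState
      (AssistedDistillation.isState_multipartitePower hψ n) T).trans <|
    (AssistedDistillation.distillable_cutState_multipartitePower_le hψ T n).trans <|
      AssistedDistillation.distillable_bipartitePower_le
        (AssistedDistillation.isState_cutState hψ T) hn
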